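/- For a triangle $ABC$ in the Euclidean plane let $a=BC$, $b=CA$, $c=AB$ be its side lengths and $\alpha,\beta,\gamma$ its angles at $A,B,C$. Triangles with ordered vertices, considered up to similarity, are identified with the points $(x,y)=(a/c,\,b/c)$ of $$M=\{(x,y)\in\mathbb R^2:\ x+1>y,\ y+1>x,\ x+y>1\}.$$ Let $\mathbb K$ be the smallest subfield of $\mathbb R$ that contains $\sqrt k$ for every natural number $k$, and let $\Sigma\subset M$ be the set of (similarity classes of) triangles such that - $q_1\alpha+q_2\beta+q_3\gamma=0$ for some rational numbers $(q_1,q_2,q_3)\neq(0,0,0)$, or - $q_1\frac ac+q_2\frac bc+q_3=0$ for some $q_1,q_2,q_3\in\mathbb K$ with $(q_1,q_2)\ne(0,0)$. A dissection of a triangle $\Delta$ into mutually congruent triangles is a finite family of pairwise congruent nondegenerate triangles (mirror images are allowed, and the triangles need not meet edge to edge) that have pairwise disjoint interiors and whose union is $\Delta$. For $n\ge1$, the standard dissection of $\Delta$ into $n^2$ triangles is the one obtained by dividing each side of $\Delta$ into $n$ equal parts and drawing through the division points all lines parallel to the sides of $\Delta$; its $n^2$ tiles are copies of $\Delta$ scaled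 by $1/n$. **Theorem.** The set $\Sigma$ has Lebesgue measure zero, and for every triangle $\Delta$ whose similarity class lies in $M\setminus\Sigma$ (hence for almost every triangle), every dissection of $\Delta$ into mutually congruent triangles is, for some natural number $n\ge1$, the standard dissection of $\Delta$ into $n^2$ triangles. -/

import Mathlib

noncomputable section

namespace TriangleTiling

/-- The Euclidean plane. -/
abbrev Plane : Type := EuclideanSpace ℝ (Fin 2)

/-- A (nondegenerate) triangle of the plane, with ordered vertices `points 0`, `points 1`,
`points 2`. -/
abbrev Tri : Type := Affine.Triangle ℝ Plane

/-- The closed region bounded by a triangle. -/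
def region (D : Tri) : Set Plane := convexHull ℝ (Set.range D.points)

/-- Two triangles are congruent: some matching of their vertices preserves all distances
(mirror images are congruent). -/
def TriCongruent (D E : Tri) : Prop :=
  ∃ σ : Equiv.Perm (Fin 3), Congruent (D.points ∘ σ) E.points

/-- The triangles `T 0, …, T (m - 1)` dissect `D` into mutually congruent triangles: they cover
exactly `D`, their interiors are pairwise disjoint, and any two of them are congruent. They are
not required to meet edge to edge. -/
structure IsCongruentDissection (D : Tri) {m : ℕ} (T : Fin m → Tri) : Prop where
  iUnion_eq : (⋃ i, region (T i)) = region D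
  disjoint_interior : ∀ i j, i ≠ j → Disjoint (interior (region (T i))) (interior (region (T j)))
  congruent : ∀ i j, TriCongruent (T i) (T j)

/-- The point `A + (i / n) (B - A) + (j / n) (C - A)` of the lattice that subdivides `D = ABC`. -/
def latticePoint (D : Tri) (n i j : ℕ) : Plane :=
  D.points 0 + ((i : ℝ) / n) • (D.points 1 - D.points 0)
    + ((j : ℝ) / n) • (D.points 2 - D.points 0)

/-- The copy of `D` scaled by `1 / n`, translated so that its vertex `A` becomes the lattice point
`(i, j)`; its other vertices are the lattice points `(i + 1, j)` and `(i, j + 1)`. -/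
def upTile (D : Tri) (n i j : ℕ) : Set Plane :=
  (fun x : Plane => latticePoint D n i j + (1 / (n : ℝ)) • (x - D.points 0)) '' region D

/-- The copy of `D` scaled by `1 / n` and turned by a half-turn, whose vertices are the lattice
points `(i + 1, j + 1)`, `(i, j + 1)` and `(i + 1, j)`. -/
def downTile (D : Tri) (n i j : ℕ) : Set Plane :=
  (fun x : Plane => latticePoint D n (i + 1) (j + 1) - (1 / (n : ℝ)) • (x - D.points 0)) ''
    region D

/-- The tiles of the standard dissection of `D` into `n ^ 2` triangles: the small triangles cut out
by the lines that divide each side into `n` equal parts and are parallel to the sides. -/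
def standardDissection (D : Tri) (n : ℕ) : Set (Set Plane) :=
  {t | ∃ i j : ℕ, i + j + 1 ≤ n ∧ t = upTile D n i j} ∪
    {t | ∃ i j : ℕ, i + j + 2 ≤ n ∧ t = downTile D n i j}

/-- The space of triangles with ordered vertices up to similarity: the side lengths `(x, y, 1)`. -/
def triangleSpace : Set (ℝ × ℝ) := {p | p.1 + 1 > p.2 ∧ p.2 + 1 > p.1 ∧ p.1 + p.2 > 1}

/-- The point `(BC / AB, CA / AB)` of `triangleSpace` that represents the triangle `D = ABC`. -/
def shape (D : Tri) : ℝ × ℝ :=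
  (dist (D.points 1) (D.points 2) / dist (D.points 0) (D.points 1),
    dist (D.points 2) (D.points 0) / dist (D.points 0) (D.points 1))

/-- The pairs `(α, β)` for which `(α, β, π - α - β)` are the angles of a triangle. -/
def angleSpace : Set (ℝ × ℝ) := {p | p.1 > 0 ∧ p.2 > 0 ∧ p.1 + p.2 < Real.pi}

/-- The shape of the triangle with angles `α`, `β`, `γ = π - α - β` at `A`, `B`, `C`: its sides are
`(sin α / sin γ, sin β / sin γ, 1)` by the law of sines. -/
def shapeOfAngles (p : ℝ × ℝ) : ℝ × ℝ :=
  (Real.sin p.1 / Real.sin (Real.pi - p.1 - p.2), Real.sin p.2 / Real.sin (Real.pi - p.1 - p.2))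

/-- The pairs `(α, β)` with `α`, `β`, `π - α - β` linearly dependent over `ℚ`. -/
def angleLines : Set (ℝ × ℝ) :=
  {p | ∃ q₁ q₂ q₃ : ℚ, (q₁, q₂, q₃) ≠ (0, 0, 0) ∧
    (q₁ : ℝ) * p.1 + (q₂ : ℝ) * p.2 + (q₃ : ℝ) * (Real.pi - p.1 - p.2) = 0}

/-- The smallest subfield of `ℝ` that contains the square roots of all natural numbers. -/
def sqrtField : Subfield ℝ := Subfield.closure (Set.range fun n : ℕ => Real.sqrt n)

/-- The union of the lines `q₁ x + q₂ y + q₃ = 0` with coefficients in `sqrtField`. -/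
def sideLines : Set (ℝ × ℝ) :=
  {p | ∃ q₁ ∈ sqrtField, ∃ q₂ ∈ sqrtField, ∃ q₃ ∈ sqrtField, (q₁, q₂) ≠ (0, 0) ∧
    q₁ * p.1 + q₂ * p.2 + q₃ = 0}

/-- The exceptional shapes: the angles are commensurable over `ℚ`, or the sides are commensurable
over `sqrtField`. -/
def exceptionalSet : Set (ℝ × ℝ) :=
  (shapeOfAngles '' (angleLines ∩ angleSpace) ∪ sideLines) ∩ triangleSpace

end TriangleTiling

end

/-!
Null set.  `angleLines` and `sideLines` are countable unions of lines, `sqrtField` being countable,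
and `shapeOfAngles` is differentiable on `angleSpace`, so that it maps null sets to null sets.
Conversely a triangle whose shape is not exceptional has angles that are independent over `ℚ` and
sides that are independent over `sqrtField`. Of the latter only integral relations are needed.

Tiles are similar to `D`.  Comparing areas in a small disk around `p` shows that the angles of the
tiles at `p` add up to the angle of `D` at `p` (`sum_localAngle`). At the vertices of `D` this
writes the angles of `D` as sums of angles of one tile with natural coefficients. Independence
leaves only a permutation (`exists_perm_of_combination`), so the tiles are copies of `D` scaled by
some `ρ`. Hence the angle sums split: at every point, each angle of `D` occurs as often among the
tiles as `D` itself prescribes, once at its own vertex of `D`, never at the others, once on an open side and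
twice in the interior (`sum_weight`, in which a tile with `p` on an open side or in its interior
counts for all three angles, once or twice).

Walking.  Along a segment that no tile crosses the sides of the tiles on one side of it follow each
other (`IsBarrier.length_eq`), until the end of the segment is a vertex of a tile or a tile passes
it. In the first case the length of the segment is `ρ` times a sum of sides, and the independence
of the sides says how many of each type there are. For the side `AB`, with areas, this gives
`ρ = 1 / n` and `m = n ^ 2`.

Rows.  With the lattice that divides the sides of `D` into `n` parts, the tiles are shown to be the
lattice triangles row by row, upwards from `AB`. On a segment of lattice length `k` above a finished
row the walk meets exactly `k` sides of type `AB`. As each angle occurs at most twice at a point,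
the tiles standing on it are the upright ones (`IsLatticeDissection.row`), and the gap between two
neighbours is filled either by the inverted triangle or by its mirror image in the bisector of the
gap (`IsLatticeDissection.gap`).

No mirror images.  A mirror image has a side of type `CA` along a line on which the tiles to the
left have sides of type `BC`. Walking up this line, the two sides of it cannot match at the next
lattice height, so some tile on the right passes that point. It shields the part of the row to the
left of the line, where either a gap is again filled by a mirror image or all gaps are filled
properly. In the latter case the next row can be filled, which gives the same situation one step
higher on a shorter segment. On reaching the side `CA` no tile can pass, and this is a contradiction
(`IsLatticeDissection.no_mirror`). So all lattice triangles are tiles, and since they cover `D`,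
there are no others.
-/

namespace TriangleTiling

open MeasureTheory Filter Topology

/-! ### The exceptional set is null -/

lemma countable_sqrtField : (sqrtField : Set ℝ).Countable := by
  rw [← Cardinal.le_aleph0_iff_set_countable]
  refine (Subfield.cardinalMk_closure_le_max _).trans (max_le ?_ le_rfl)
  exact (Set.countable_range _).le_aleph0

lemma volume_line_eq_zero {a b : ℝ} (c : ℝ) (h : a ≠ 0 ∨ b ≠ 0) :
    MeasureTheory.volume {p : ℝ × ℝ | a * p.1 + b * p.2 + c = 0} = 0 := by
  let f : ℝ × ℝ →ᵃ[ℝ] ℝ :=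
    (a • LinearMap.fst ℝ ℝ ℝ + b • LinearMap.snd ℝ ℝ ℝ).toAffineMap + AffineMap.const ℝ _ c
  let s : AffineSubspace ℝ (ℝ × ℝ) := (AffineSubspace.mk' (0 : ℝ) ⊥).comap f
  have hs : ({p : ℝ × ℝ | a * p.1 + b * p.2 + c = 0}) = s := by
    ext p
    simp [s, f]
  rw [hs]
  apply MeasureTheory.Measure.addHaar_affineSubspace
  intro htop
  have hall : ∀ p : ℝ × ℝ, a * p.1 + b * p.2 + c = 0 := fun p => by
    have : p ∈ (s : Set (ℝ × ℝ)) := by rw [htop]; trivial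
    rwa [← hs] at this
  have h0 := hall (0, 0)
  have h1 := hall (1, 0)
  have h2 := hall (0, 1)
  simp at h0 h1 h2
  rcases h with h | h <;> apply h <;> linarith

lemma volume_sideLines : MeasureTheory.volume sideLines = 0 := by
  have hsub : sideLines ⊆ ⋃ q ∈ {q : ℝ × ℝ × ℝ | (q.1 ∈ sqrtField ∧ q.2.1 ∈ sqrtField ∧
      q.2.2 ∈ sqrtField) ∧ (q.1 ≠ 0 ∨ q.2.1 ≠ 0)},
      {p : ℝ × ℝ | q.1 * p.1 + q.2.1 * p.2 + q.2.2 = 0} := by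
    rintro p ⟨q₁, h₁, q₂, h₂, q₃, h₃, hne, h⟩
    refine Set.mem_biUnion (x := (q₁, q₂, q₃)) ⟨⟨h₁, h₂, h₃⟩, ?_⟩ h
    by_contra! hc
    exact hne (Prod.ext hc.1 hc.2)
  refine MeasureTheory.measure_mono_null hsub ?_
  refine (MeasureTheory.measure_biUnion_null_iff ?_).2 fun q hq => volume_line_eq_zero _ hq.2
  refine Set.Countable.mono (s₂ := (sqrtField : Set ℝ) ×ˢ ((sqrtField : Set ℝ) ×ˢ
    (sqrtField : Set ℝ))) (fun q hq => ⟨hq.1.1, hq.1.2.1, hq.1.2.2⟩) ?_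
  exact countable_sqrtField.prod (countable_sqrtField.prod countable_sqrtField)

lemma volume_angleLines : MeasureTheory.volume angleLines = 0 := by
  have hsub : angleLines ⊆ ⋃ q ∈ {q : ℚ × ℚ × ℚ | (((q.1 : ℝ) - q.2.2) ≠ 0 ∨
      ((q.2.1 : ℝ) - q.2.2) ≠ 0)},
      {p : ℝ × ℝ | ((q.1 : ℝ) - q.2.2) * p.1 + ((q.2.1 : ℝ) - q.2.2) * p.2
        + q.2.2 * Real.pi = 0} := by
    rintro p ⟨q₁, q₂, q₃, hne, h⟩
    refine Set.mem_biUnion (x := (q₁, q₂, q₃)) ?_ ?_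
    · by_contra hc
      simp only [Set.mem_ofPred_eq, not_or, not_not] at hc
      obtain ⟨h1, h2⟩ := hc
      have e1 : (q₁ : ℝ) = q₃ := by linarith
      have e2 : (q₂ : ℝ) = q₃ := by linarith
      rw [e1, e2] at h
      have : (q₃ : ℝ) * Real.pi = 0 := by linarith
      have h3 : (q₃ : ℝ) = 0 := by simpa [Real.pi_ne_zero] using this
      rw [h3] at e1 e2
      exact hne (by norm_cast at *; simp [e1, e2, h3])
    · simp only [Set.mem_ofPred_eq]
      linarith
  refine MeasureTheory.measure_mono_null hsub ?_
  exact (MeasureTheory.measure_biUnion_null_iff (Set.to_countable _)).2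
    fun q hq => volume_line_eq_zero _ hq

theorem volume_exceptionalSet : MeasureTheory.volume exceptionalSet = 0 := by
  refine MeasureTheory.measure_mono_null Set.inter_subset_left ?_
  refine MeasureTheory.measure_union_null ?_ volume_sideLines
  refine MeasureTheory.addHaar_image_eq_zero_of_differentiableOn_of_addHaar_eq_zero
    MeasureTheory.volume ?_ (MeasureTheory.measure_mono_null Set.inter_subset_left
      volume_angleLines)
  intro p hp
  obtain ⟨-, h1, h2, h3⟩ := hp
  have : Real.sin (Real.pi - p.1 - p.2) ≠ 0 :=
    (Real.sin_pos_of_pos_of_lt_pi (by linarith) (by linarith)).ne'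
  apply DifferentiableAt.differentiableWithinAt
  unfold shapeOfAngles
  fun_prop (disch := assumption)

/-! ### The area of a circular sector -/

/-- In polar coordinates the sector is the rectangle `(0, r) × (0, ω)`. -/
theorem volume_planar_sector {ω r : ℝ} (h0 : 0 < ω) (hπ : ω ≤ Real.pi) (hr : 0 < r) :
    volume {q : ℝ × ℝ | 0 < q.2 ∧ 0 < q.1 * Real.sin ω - q.2 * Real.cos ω ∧
      q.1 ^ 2 + q.2 ^ 2 < r ^ 2} = ENNReal.ofReal (ω * r ^ 2 / 2) := by
  set S := {q : ℝ × ℝ | 0 < q.2 ∧ 0 < q.1 * Real.sin ω - q.2 * Real.cos ω ∧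
      q.1 ^ 2 + q.2 ^ 2 < r ^ 2} with hS
  have hSm : MeasurableSet S := by
    have o1 : IsOpen {q : ℝ × ℝ | 0 < q.2} := isOpen_lt (by fun_prop) (by fun_prop)
    have o2 : IsOpen {q : ℝ × ℝ | 0 < q.1 * Real.sin ω - q.2 * Real.cos ω} :=
      isOpen_lt (by fun_prop) (by fun_prop)
    have o3 : IsOpen {q : ℝ × ℝ | q.1 ^ 2 + q.2 ^ 2 < r ^ 2} :=
      isOpen_lt (by fun_prop) (by fun_prop)
    exact (o1.inter (o2.inter o3)).measurableSet
  rw [← lintegral_indicator_one hSm, ← lintegral_comp_polarCoord_symm,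
    ← lintegral_indicator polarCoord.open_target.measurableSet]
  have key : (polarCoord.target.indicator fun p : ℝ × ℝ =>
      ENNReal.ofReal p.1 • S.indicator (1 : ℝ × ℝ → ENNReal) (polarCoord.symm p)) =
      fun p : ℝ × ℝ => ((Set.Ioo 0 r).indicator (fun s => ENNReal.ofReal s) p.1) *
        ((Set.Ioo 0 ω).indicator 1 p.2) := by
    funext p
    obtain ⟨s, θ⟩ := p
    by_cases ht : (s, θ) ∈ polarCoord.target
    · rw [Set.indicator_of_mem ht]
      simp only [polarCoord_target, Set.mem_prod, Set.mem_Ioi, Set.mem_Ioo] at ht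
      obtain ⟨hs, hθ1, hθ2⟩ := ht
      have hmem : polarCoord.symm (s, θ) ∈ S ↔ s ∈ Set.Ioo 0 r ∧ θ ∈ Set.Ioo 0 ω := by
        simp only [polarCoord_symm_apply, hS, Set.mem_ofPred_eq, Set.mem_Ioo]
        have e1 : s * Real.cos θ * Real.sin ω - s * Real.sin θ * Real.cos ω =
            s * Real.sin (ω - θ) := by rw [Real.sin_sub]; ring
        have e2 : (s * Real.cos θ) ^ 2 + (s * Real.sin θ) ^ 2 = s ^ 2 := by
          linear_combination s ^ 2 * Real.sin_sq_add_cos_sq θ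
        rw [e1, e2, mul_pos_iff_of_pos_left hs, mul_pos_iff_of_pos_left hs,
          sq_lt_sq₀ hs.le hr.le]
        have hθ : 0 < Real.sin θ ↔ 0 < θ := by
          constructor
          · intro h
            by_contra! hc
            exact absurd (Real.sin_nonpos_of_nonpos_of_neg_pi_le hc hθ1.le) (not_le.2 h)
          · exact fun h => Real.sin_pos_of_pos_of_lt_pi h hθ2
        rw [hθ]
        constructor
        · rintro ⟨h1, h2, h3⟩
          refine ⟨⟨hs, h3⟩, h1, ?_⟩
          by_contra! hc
          exact absurd (Real.sin_nonpos_of_nonpos_of_neg_pi_le (x := ω - θ) (by linarith)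
            (by linarith)) (not_le.2 h2)
        · rintro ⟨⟨_, h1⟩, h2, h3⟩
          exact ⟨h2, Real.sin_pos_of_pos_of_lt_pi (by linarith) (by linarith), h1⟩
      by_cases h1 : s ∈ Set.Ioo 0 r <;> by_cases h2 : θ ∈ Set.Ioo 0 ω
      · rw [Set.indicator_of_mem (hmem.2 ⟨h1, h2⟩), Set.indicator_of_mem h1,
          Set.indicator_of_mem h2]; simp
      all_goals
        rw [Set.indicator_of_notMem (by rw [hmem]; tauto)]
        simp [h1, h2]
    · rw [Set.indicator_of_notMem ht]
      simp only [polarCoord_target, Set.mem_prod, Set.mem_Ioi, Set.mem_Ioo] at ht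
      by_cases h1 : s ∈ Set.Ioo 0 r
      · have h2 : θ ∉ Set.Ioo 0 ω := fun h2 =>
          ht ⟨h1.1, by have := h2.1; linarith [Real.pi_pos], lt_of_lt_of_le h2.2 hπ⟩
        simp [h2]
      · simp [h1]
  rw [key, Measure.volume_eq_prod, lintegral_prod_mul]
  · rw [lintegral_indicator measurableSet_Ioo, lintegral_indicator measurableSet_Ioo]
    simp only [Pi.one_apply, lintegral_one, Measure.restrict_apply_univ, Real.volume_Ioo, sub_zero]
    rw [← ofReal_integral_eq_lintegral_ofReal]
    · rw [← integral_Ioc_eq_integral_Ioo, ← intervalIntegral.integral_of_le hr.le, integral_id,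
        ← ENNReal.ofReal_mul (by nlinarith)]
      congr 1; ring
    · exact (continuous_id.integrableOn_Icc (a := 0) (b := r)).mono_set Set.Ioo_subset_Icc_self
    · exact (ae_restrict_mem measurableSet_Ioo).mono fun x hx => hx.1.le
  · exact (ENNReal.measurable_ofReal.indicator measurableSet_Ioo).aemeasurable
  · exact (measurable_one.indicator measurableSet_Ioo).aemeasurable

/-- Two independent vectors in the frame whose first vector points along `u` and whose second one
lies on the side of `v`. -/
lemma exists_adapted_orthonormalBasis {u v : Plane}
    (h : Real.sin (InnerProductGeometry.angle u v) ≠ 0) (hu : u ≠ 0) (hv : v ≠ 0) :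
    ∃ b : OrthonormalBasis (Fin 2) ℝ Plane, u = ‖u‖ • b 0 ∧
      v = (‖v‖ * Real.cos (InnerProductGeometry.angle u v)) • b 0 +
        (‖v‖ * Real.sin (InnerProductGeometry.angle u v)) • b 1 := by
  set ω := InnerProductGeometry.angle u v with hω
  have hu' : ‖u‖ ≠ 0 := norm_ne_zero_iff.2 hu
  have hv' : ‖v‖ ≠ 0 := norm_ne_zero_iff.2 hv
  have huv : inner ℝ u v = ‖u‖ * ‖v‖ * Real.cos ω := by
    rw [hω, InnerProductGeometry.cos_angle]; field_simp
  have hsc := Real.sin_sq_add_cos_sq ω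
  obtain ⟨e, he⟩ : ∃ e : Plane, e = ‖u‖⁻¹ • u := ⟨_, rfl⟩
  obtain ⟨w, hw⟩ : ∃ w : Plane, w = (‖v‖ * Real.sin ω)⁻¹ • (v - (‖v‖ * Real.cos ω) • e) :=
    ⟨_, rfl⟩
  have hee : inner ℝ e e = (1 : ℝ) := by
    rw [he, real_inner_smul_left, real_inner_smul_right, real_inner_self_eq_norm_sq]; field_simp
  have hev : inner ℝ e v = ‖v‖ * Real.cos ω := by
    rw [he, real_inner_smul_left, huv]; field_simp
  have hew : inner ℝ e w = (0 : ℝ) := by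
    rw [hw, real_inner_smul_right, inner_sub_right, real_inner_smul_right, hee, hev]; ring
  have hww : inner ℝ w w = (1 : ℝ) := by
    have hve : inner ℝ v e = ‖v‖ * Real.cos ω := by rw [real_inner_comm, hev]
    have hvv : inner ℝ v v = ‖v‖ ^ 2 := real_inner_self_eq_norm_sq v
    simp only [hw, real_inner_smul_left, real_inner_smul_right, inner_sub_right, inner_sub_left,
      hee, hev, hve, hvv]
    field_simp
    linarith
  have hon : Orthonormal ℝ ![e, w] := by
    rw [orthonormal_iff_ite]
    intro i j
    have hwe : inner ℝ w e = (0 : ℝ) := by rw [real_inner_comm, hew]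
    fin_cases i <;> fin_cases j <;>
      simp only [Fin.zero_eta, Fin.mk_one, Fin.isValue, Matrix.cons_val_zero, Matrix.cons_val_one,
        hee, hew, hwe, hww] <;> simp
  have hcard : Fintype.card (Fin 2) = Module.finrank ℝ Plane := by simp
  refine ⟨(basisOfOrthonormalOfCardEqFinrank hon hcard).toOrthonormalBasis (by simpa using hon),
    ?_, ?_⟩
  · simp [he, smul_smul, hu']
  · simp only [Module.Basis.coe_toOrthonormalBasis, coe_basisOfOrthonormalOfCardEqFinrank,
      Matrix.cons_val_zero, Matrix.cons_val_one]
    rw [hw, smul_smul, mul_inv_cancel₀ (mul_ne_zero hv' h), one_smul, add_sub_cancel]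

theorem volume_sector {u v : Plane} (h : Real.sin (InnerProductGeometry.angle u v) ≠ 0)
    (hu : u ≠ 0) (hv : v ≠ 0) (p : Plane) {r : ℝ} (hr : 0 < r) :
    volume {x : Plane | (∃ s t : ℝ, 0 < s ∧ 0 < t ∧ x = p + (s • u + t • v)) ∧
      x ∈ Metric.ball p r} =
      ENNReal.ofReal (InnerProductGeometry.angle u v * r ^ 2 / 2) := by
  obtain ⟨b, hbu, hbv⟩ := exists_adapted_orthonormalBasis h hu hv
  set ω := InnerProductGeometry.angle u v with hω
  have hω0 : 0 < ω := by
    rcases (InnerProductGeometry.angle_nonneg u v).lt_or_eq with h' | h'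
    · exact h'
    · exact absurd (by rw [hω, ← h', Real.sin_zero]) h
  have hu' : 0 < ‖u‖ := norm_pos_iff.2 hu
  have hv' : 0 < ‖v‖ := norm_pos_iff.2 hv
  have hsin : 0 < Real.sin ω :=
    lt_of_le_of_ne (Real.sin_nonneg_of_nonneg_of_le_pi hω0.le
      (InnerProductGeometry.angle_le_pi u v)) (Ne.symm h)
  have hmp : MeasurePreserving
      (fun x : Plane => MeasurableEquiv.finTwoArrow
        ((MeasurableEquiv.toLp 2 (Fin 2 → ℝ)).symm (b.repr (x - p)))) volume volume := by
    refine (volume_preserving_finTwoArrow ℝ).comp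
      ((EuclideanSpace.volume_preserving_symm_measurableEquiv_toLp (Fin 2)).comp
        (b.measurePreserving_repr.comp (measurePreserving_sub_right volume p)))
  have hmeas : MeasurableSet {q : ℝ × ℝ | 0 < q.2 ∧ 0 < q.1 * Real.sin ω - q.2 * Real.cos ω ∧
      q.1 ^ 2 + q.2 ^ 2 < r ^ 2} := by
    have o1 : IsOpen {q : ℝ × ℝ | 0 < q.2} := isOpen_lt (by fun_prop) (by fun_prop)
    have o2 : IsOpen {q : ℝ × ℝ | 0 < q.1 * Real.sin ω - q.2 * Real.cos ω} :=
      isOpen_lt (by fun_prop) (by fun_prop)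
    have o3 : IsOpen {q : ℝ × ℝ | q.1 ^ 2 + q.2 ^ 2 < r ^ 2} :=
      isOpen_lt (by fun_prop) (by fun_prop)
    exact (o1.inter (o2.inter o3)).measurableSet
  rw [← volume_planar_sector hω0 (InnerProductGeometry.angle_le_pi u v) hr,
    ← hmp.measure_preimage hmeas.nullMeasurableSet]
  congr 1
  ext x
  have hx : x - p = b.repr (x - p) 0 • b 0 + b.repr (x - p) 1 • b 1 := by
    conv_lhs => rw [← b.sum_repr (x - p), Fin.sum_univ_two]
  have hnorm : x ∈ Metric.ball p r ↔
      (b.repr (x - p) 0) ^ 2 + (b.repr (x - p) 1) ^ 2 < r ^ 2 := by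
    rw [mem_ball_iff_norm, ← sq_lt_sq₀ (norm_nonneg _) hr.le, ← b.repr.norm_map,
      EuclideanSpace.real_norm_sq_eq, Fin.sum_univ_two]
  simp only [Set.mem_ofPred_eq, Set.mem_preimage]
  change _ ↔ 0 < b.repr (x - p) 1 ∧ 0 < b.repr (x - p) 0 * _ - b.repr (x - p) 1 * _ ∧
    (b.repr (x - p) 0) ^ 2 + (b.repr (x - p) 1) ^ 2 < r ^ 2
  rw [← hnorm, ← and_assoc]
  refine and_congr_left fun _ => ⟨?_, ?_⟩
  · rintro ⟨s, t, hs, ht, hxe⟩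
    have hd : x - p = (s * ‖u‖ + t * (‖v‖ * Real.cos ω)) • b 0 +
        (t * (‖v‖ * Real.sin ω)) • b 1 := by
      rw [hxe, add_sub_cancel_left]
      conv_lhs => rw [hbu, hbv]
      module
    have h0 : b.repr (x - p) 0 = s * ‖u‖ + t * (‖v‖ * Real.cos ω) := by
      rw [hd]; simp
    have h1 : b.repr (x - p) 1 = t * (‖v‖ * Real.sin ω) := by
      rw [hd]; simp
    rw [h0, h1]
    refine ⟨by positivity, ?_⟩
    have : (s * ‖u‖ + t * (‖v‖ * Real.cos ω)) * Real.sin ω -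
        t * (‖v‖ * Real.sin ω) * Real.cos ω = s * ‖u‖ * Real.sin ω := by ring
    rw [this]; positivity
  · rintro ⟨h1, h2⟩
    refine ⟨(b.repr (x - p) 0 * Real.sin ω - b.repr (x - p) 1 * Real.cos ω) /
      (‖u‖ * Real.sin ω), b.repr (x - p) 1 / (‖v‖ * Real.sin ω), by positivity, by positivity, ?_⟩
    clear hnorm
    rw [← sub_eq_iff_eq_add']
    generalize b.repr (x - p) 0 = x₀ at *
    generalize b.repr (x - p) 1 = x₁ at *
    rw [hx]
    generalize ‖u‖ = U at *
    generalize ‖v‖ = V at *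
    rw [hbu, hbv, smul_smul, smul_add, smul_smul, smul_smul, ← add_assoc, ← add_smul]
    congr 2
    · field_simp
      ring
    · field_simp

/-! ### Barycentric coordinates and local angles of a triangle -/

/-- The vertices of a triangle as an affine basis of the plane. -/
noncomputable def bary (T : Tri) : AffineBasis (Fin 3) ℝ Plane :=
  ⟨T.points, T.independent, by
    rw [T.independent.affineSpan_eq_top_iff_card_eq_finrank_add_one]; simp⟩

lemma bary_apply (T : Tri) (i : Fin 3) : bary T i = T.points i := rfl

lemma bary_coord_points (T : Tri) (i j : Fin 3) :
    (bary T).coord i (T.points j) = if i = j then 1 else 0 := (bary T).coord_apply i j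

lemma bary_coord_sum (T : Tri) (p : Plane) :
    (bary T).coord 0 p + (bary T).coord 1 p + (bary T).coord 2 p = 1 := by
  rw [← (bary T).sum_coord_apply_eq_one p, Fin.sum_univ_three]

lemma bary_ext (T : Tri) {p q : Plane} (h : ∀ i, (bary T).coord i p = (bary T).coord i q) :
    p = q := (bary T).ext_elem h

lemma bary_continuous (T : Tri) (i : Fin 3) : Continuous ((bary T).coord i) :=
  ((bary T).coord i).continuous_of_finiteDimensional

lemma mem_region {T : Tri} {p : Plane} : p ∈ region T ↔ ∀ i, 0 ≤ (bary T).coord i p := by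
  have := (bary T).convexHull_eq_nonneg_coord
  change p ∈ convexHull ℝ (Set.range (bary T)) ↔ _
  rw [this]; rfl

lemma mem_interior_region {T : Tri} {p : Plane} :
    p ∈ interior (region T) ↔ ∀ i, 0 < (bary T).coord i p := by
  have := (bary T).interior_convexHull
  change p ∈ interior (convexHull ℝ (Set.range (bary T))) ↔ _
  rw [this]; rfl

lemma convex_region (T : Tri) : Convex ℝ (region T) := convex_convexHull _ _

lemma isCompact_region (T : Tri) : IsCompact (region T) :=
  (Set.finite_range _).isCompact_convexHull (𝕜 := ℝ)

lemma isClosed_region (T : Tri) : IsClosed (region T) := (isCompact_region T).isClosed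

lemma points_mem_region (T : Tri) (i : Fin 3) : T.points i ∈ region T :=
  subset_convexHull _ _ (Set.mem_range_self i)

lemma interior_region_ae_eq (T : Tri) : interior (region T) =ᵐ[volume] region T :=
  interior_ae_eq_of_null_frontier ((convex_region T).addHaar_frontier volume)

/-- The angle of a triangle at its vertex `k`. -/
noncomputable def ang (T : Tri) (k : Fin 3) : ℝ :=
  EuclideanGeometry.angle (T.points (k + 1)) (T.points k) (T.points (k + 2))

lemma points_ne {T : Tri} {i j : Fin 3} (h : i ≠ j) : T.points i ≠ T.points j :=
  fun e => h (T.independent.injective e)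

lemma not_collinear_points (T : Tri) (k : Fin 3) :
    ¬ Collinear ℝ {T.points (k + 1), T.points k, T.points (k + 2)} := by
  have h := T.independent.comp_embedding
    ⟨![k + 1, k, k + 2], by revert k; decide⟩
  rw [affineIndependent_iff_not_collinear] at h
  convert h using 2
  ext x
  simp [Matrix.range_cons, Set.range_comp, Set.image_insert_eq]
  tauto

lemma sin_ang_ne_zero (T : Tri) (k : Fin 3) : Real.sin (ang T k) ≠ 0 :=
  (EuclideanGeometry.sin_pos_of_not_collinear (not_collinear_points T k)).ne'

lemma ang_pos (T : Tri) (k : Fin 3) : 0 < ang T k :=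
  EuclideanGeometry.angle_pos_of_not_collinear (not_collinear_points T k)

lemma ang_sum (T : Tri) : ang T 0 + ang T 1 + ang T 2 = Real.pi := by
  have := EuclideanGeometry.angle_add_angle_add_angle_eq_pi (T.points 2)
    (points_ne (T := T) (show (1 : Fin 3) ≠ 0 by decide))
  rw [← this]
  simp only [ang]
  rw [EuclideanGeometry.angle_comm (T.points (0 + 1))]
  change EuclideanGeometry.angle (T.points 2) (T.points 0) (T.points 1) +
    EuclideanGeometry.angle (T.points 2) (T.points 1) (T.points 0) +
    EuclideanGeometry.angle (T.points 0) (T.points 2) (T.points 1) = _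
  rw [EuclideanGeometry.angle_comm (T.points 2) (T.points 1),
    EuclideanGeometry.angle_comm (T.points 0) (T.points 2)]
  ring

open Classical in
/-- How many times the angle of a triangle `T` at its vertex `k` enters the angle under which `T` is
seen from the point `p`: a vertex of `T` sees just the angle there, an inner point of a side
sees `π`, the sum of the three angles, and an interior point sees `2 π`. -/
noncomputable def weight (T : Tri) (p : Plane) (k : Fin 3) : ℕ :=
  if p ∈ interior (region T) then 2
  else if ∃ j, p = T.points j then (if p = T.points k then 1 else 0)
  else if p ∈ region T then 1 else 0

lemma points_notMem_interior (T : Tri) (i : Fin 3) : T.points i ∉ interior (region T) := by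
  intro h
  have h1 := mem_interior_region.1 h (i + 1)
  rw [bary_coord_points, if_neg ((by decide : ∀ i : Fin 3, i + 1 ≠ i) i)] at h1
  exact lt_irrefl _ h1

lemma weight_points (T : Tri) (i k : Fin 3) :
    weight T (T.points i) k = if i = k then 1 else 0 := by
  rw [weight, if_neg (points_notMem_interior T i), if_pos ⟨i, rfl⟩]
  simp [T.independent.injective.eq_iff]

lemma weight_le_two (T : Tri) (p : Plane) (k : Fin 3) : weight T p k ≤ 2 := by
  unfold weight; split_ifs <;> omega

lemma weight_le_one {T : Tri} {p : Plane} (h : p ∉ interior (region T)) (k : Fin 3) :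
    weight T p k ≤ 1 := by
  unfold weight; split_ifs <;> omega

/-- Every point of the open sides is inner to exactly one side. -/
lemma exists_opposite_of_mem_side {T : Tri} {p : Plane} (h1 : p ∈ region T)
    (h2 : p ∉ interior (region T)) (h3 : ∀ j, p ≠ T.points j) :
    ∃ i, (bary T).coord i p = 0 ∧ ∀ j, j ≠ i → 0 < (bary T).coord j p := by
  rw [mem_region] at h1
  rw [mem_interior_region] at h2
  push Not at h2
  obtain ⟨i, hi⟩ := h2
  have hi0 : (bary T).coord i p = 0 := le_antisymm hi (h1 i)
  refine ⟨i, hi0, fun j hj => lt_of_le_of_ne (h1 j) fun hj0 => ?_⟩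
  obtain ⟨k, hk⟩ : ∃ k, k ≠ i ∧ k ≠ j :=
    (by decide : ∀ i j : Fin 3, ∃ k, k ≠ i ∧ k ≠ j) i j
  refine h3 k (bary_ext T fun l => ?_)
  rw [bary_coord_points]
  have hs := bary_coord_sum T p
  have hall : ∀ i j k l : Fin 3, j ≠ i → k ≠ i ∧ k ≠ j → l = i ∨ l = j ∨ l = k := by decide
  have hsum : (bary T).coord i p + (bary T).coord j p + (bary T).coord k p = 1 := by
    rw [← hs]
    clear hs hi hi0 hj0 h1 h3
    fin_cases i <;> fin_cases j <;> fin_cases k <;> simp_all <;> ring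
  rcases hall i j k l hj hk with rfl | rfl | rfl
  · rw [hi0, if_neg (Ne.symm hk.1)]
  · rw [← hj0, if_neg (Ne.symm hk.2)]
  · rw [if_pos rfl]; linarith


lemma weight_of_mem_side {T : Tri} {p : Plane} (h1 : p ∈ region T)
    (h2 : p ∉ interior (region T)) (h3 : ∀ j, p ≠ T.points j) (k : Fin 3) : weight T p k = 1 := by
  rw [weight, if_neg h2, if_neg (by push Not; exact h3), if_pos h1]

lemma weight_of_notMem {T : Tri} {p : Plane} (h : p ∉ region T) (k : Fin 3) :
    weight T p k = 0 := by
  rw [weight, if_neg fun h' => h (interior_subset h'), if_neg, if_neg h]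
  rintro ⟨j, rfl⟩
  exact h (points_mem_region T j)

lemma weight_of_mem_interior {T : Tri} {p : Plane} (h : p ∈ interior (region T)) (k : Fin 3) :
    weight T p k = 2 := by
  rw [weight, if_pos h]

lemma eq_vertex_add (T : Tri) (k : Fin 3) (x : Plane) :
    x = T.points k + ((bary T).coord (k + 1) x • (T.points (k + 1) - T.points k) +
      (bary T).coord (k + 2) x • (T.points (k + 2) - T.points k)) := by
  have h := (bary T).linear_combination_coord_eq_self x
  have hs := bary_coord_sum T x
  rw [Fin.sum_univ_three] at h
  simp only [bary_apply] at h
  conv_lhs => rw [← h]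
  fin_cases k
  · have e : (bary T).coord 0 x = 1 - (bary T).coord 1 x - (bary T).coord 2 x := by linarith
    rw [e]; simp only [Fin.zero_eta, zero_add]; module
  · have e : (bary T).coord 1 x = 1 - (bary T).coord 0 x - (bary T).coord 2 x := by linarith
    rw [e]; simp only [Fin.mk_one, Fin.reduceAdd]; module
  · have e : (bary T).coord 2 x = 1 - (bary T).coord 0 x - (bary T).coord 1 x := by linarith
    rw [e]; simp only [Fin.reduceFinMk, Fin.reduceAdd]; module

/-- The total angle under which a triangle is seen from a point. -/
noncomputable def localAngle (T : Tri) (p : Plane) : ℝ := ∑ k, weight T p k * ang T k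

lemma volume_vertex_ball (T : Tri) (k : Fin 3) {r : ℝ} (hr : 0 < r) :
    volume {x : Plane | (0 < (bary T).coord (k + 1) x ∧ 0 < (bary T).coord (k + 2) x) ∧
      x ∈ Metric.ball (T.points k) r} = ENNReal.ofReal (ang T k * r ^ 2 / 2) := by
  have hu : T.points (k + 1) - T.points k ≠ 0 :=
    sub_ne_zero.2 (points_ne ((by decide : ∀ i : Fin 3, i + 1 ≠ i) k))
  have hv : T.points (k + 2) - T.points k ≠ 0 :=
    sub_ne_zero.2 (points_ne ((by decide : ∀ i : Fin 3, i + 2 ≠ i) k))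
  have hsin := sin_ang_ne_zero T k
  have hvol := volume_sector (u := T.points (k + 1) - T.points k)
    (v := T.points (k + 2) - T.points k) hsin hu hv (T.points k) hr
  rw [ang, EuclideanGeometry.angle, vsub_eq_sub, vsub_eq_sub, ← hvol]
  congr 1
  ext x
  refine and_congr_left fun _ => ⟨fun h => ⟨_, _, h.1, h.2, eq_vertex_add T k x⟩, ?_⟩
  rintro ⟨s, t, hs, ht, rfl⟩
  have key : ∀ j, (bary T).coord j (T.points k + (s • (T.points (k + 1) - T.points k) +
      t • (T.points (k + 2) - T.points k))) = (if j = k then 1 else 0) +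
      (s * ((if j = k + 1 then 1 else 0) - (if j = k then 1 else 0)) +
      t * ((if j = k + 2 then 1 else 0) - (if j = k then 1 else 0))) := by
    intro j
    rw [add_comm (T.points k), ← vadd_eq_add, AffineMap.map_vadd, map_add, map_smul, map_smul,
      ← vsub_eq_sub, ← vsub_eq_sub, AffineMap.linearMap_vsub, AffineMap.linearMap_vsub]
    simp only [bary_coord_points, vadd_eq_add, vsub_eq_sub, smul_eq_mul]
    ring
  rw [key, key]
  fin_cases k <;> simp <;> exact ⟨hs, ht⟩

/-- Close to `p`, a triangle is a cone whose aperture is its local angle at `p`. -/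
theorem eventually_volume_inter_ball (T : Tri) (p : Plane) :
    ∀ᶠ r in 𝓝[>] (0 : ℝ), volume (region T ∩ Metric.ball p r) =
      ENNReal.ofReal (localAngle T p * r ^ 2 / 2) := by
  have hball : ∀ U : Set Plane, IsOpen U → p ∈ U →
      ∀ᶠ r in 𝓝[>] (0 : ℝ), Metric.ball p r ⊆ U := by
    intro U hU hp
    obtain ⟨ε, hε, hb⟩ := Metric.isOpen_iff.1 hU p hp
    filter_upwards [Ioo_mem_nhdsGT hε] with r hr
    exact (Metric.ball_subset_ball hr.2.le).trans hb
  have hae : ∀ r, volume (region T ∩ Metric.ball p r) =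
      volume (interior (region T) ∩ Metric.ball p r) := fun r =>
    measure_congr ((interior_region_ae_eq T).symm.inter (ae_eq_refl _))
  have hpos : ∀ᶠ r in 𝓝[>] (0 : ℝ), 0 < r := self_mem_nhdsWithin
  have hballvol : ∀ r, 0 < r → volume (Metric.ball p r) = ENNReal.ofReal (Real.pi * r ^ 2) := by
    intro r hr
    rw [EuclideanSpace.volume_ball_fin_two, ← ENNReal.ofReal_pow hr.le,
      ← ENNReal.ofReal_mul (by positivity), mul_comm]
  by_cases h1 : p ∈ region T
  swap
  · filter_upwards [hball _ (isClosed_region T).isOpen_compl h1] with r hr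
    have : region T ∩ Metric.ball p r = ∅ := by
      ext x; simp only [Set.mem_inter_iff, Set.mem_empty_iff_false, iff_false]
      exact fun h => hr h.2 h.1
    rw [this]
    simp [localAngle, weight_of_notMem h1]
  by_cases h2 : p ∈ interior (region T)
  · filter_upwards [hball _ isOpen_interior h2, hpos] with r hr hr0
    rw [Set.inter_eq_self_of_subset_right (hr.trans interior_subset), hballvol r hr0]
    simp only [localAngle, Fin.sum_univ_three, weight_of_mem_interior h2]
    congr 1
    rw [← ang_sum T]; push_cast; ring
  by_cases h3 : ∃ j, p = T.points j
  · obtain ⟨k, rfl⟩ := h3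
    have hU : IsOpen {x | 0 < (bary T).coord k x} :=
      isOpen_lt continuous_const (bary_continuous T k)
    filter_upwards [hball _ hU (by simp [bary_coord_points]), hpos] with r hr hr0
    have hl : localAngle T (T.points k) = ang T k := by
      simp [localAngle, weight_points]
    rw [hae, hl, ← volume_vertex_ball T k hr0]
    congr 1
    ext x
    simp only [Set.mem_inter_iff, mem_interior_region, Set.mem_ofPred_eq]
    refine and_congr_left fun hx => ⟨fun h => ⟨h _, h _⟩, fun h i => ?_⟩
    rcases (by decide : ∀ i k : Fin 3, i = k ∨ i = k + 1 ∨ i = k + 2) i k with rfl | rfl | rfl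
    exacts [hr hx, h.1, h.2]
  · push Not at h3
    obtain ⟨i, hi0, hi⟩ := exists_opposite_of_mem_side h1 h2 h3
    have hU : IsOpen {x | ∀ j, j ≠ i → 0 < (bary T).coord j x} := by
      simp only [Set.ofPred_forall]
      exact isOpen_iInter_of_finite fun j => isOpen_iInter_of_finite fun _ =>
        isOpen_lt continuous_const (bary_continuous T j)
    filter_upwards [hball _ hU hi, hpos] with r hr hr0
    set f := (bary T).coord i with hf
    have e1 : interior (region T) ∩ Metric.ball p r = {x | 0 < f x} ∩ Metric.ball p r := by
      ext x
      simp only [Set.mem_inter_iff, mem_interior_region, Set.mem_ofPred_eq]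
      refine and_congr_left fun hx => ⟨fun h => h i, fun h j => ?_⟩
      by_cases hj : j = i
      · rw [hj]; exact h
      · exact hr hx j hj
    have e2 : region T ∩ Metric.ball p r = {x | 0 ≤ f x} ∩ Metric.ball p r := by
      ext x
      simp only [Set.mem_inter_iff, mem_region, Set.mem_ofPred_eq]
      refine and_congr_left fun hx => ⟨fun h => h i, fun h j => ?_⟩
      by_cases hj : j = i
      · rw [hj]; exact h
      · exact (hr hx j hj).le
    -- the half-turn about `p` exchanges the two halves of the disc
    have e3 : volume ({x | f x < 0} ∩ Metric.ball p r) =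
        volume ({x | 0 < f x} ∩ Metric.ball p r) := by
      have hmp : MeasurePreserving (fun x : Plane => (p + p) - x) volume volume := by
          simpa [sub_eq_add_neg, Function.comp_def] using
            (measurePreserving_add_left volume (p + p)).comp (Measure.measurePreserving_neg volume)
      have hm : MeasurableSet ({x | 0 < f x} ∩ Metric.ball p r) :=
        ((isOpen_lt continuous_const (bary_continuous T i)).inter
          Metric.isOpen_ball).measurableSet
      rw [← hmp.measure_preimage hm.nullMeasurableSet]
      congr 1
      ext x
      have hfx : f (p + p - x) = - f x := by
        have : p + p - x = (p - x) +ᵥ p := by simp only [vadd_eq_add]; abel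
        rw [this, AffineMap.map_vadd, ← vsub_eq_sub, AffineMap.linearMap_vsub, hi0]
        simp
      have hbx : p + p - x ∈ Metric.ball p r ↔ x ∈ Metric.ball p r := by
        rw [mem_ball_iff_norm, mem_ball_iff_norm']
        congr! 2; abel
      simp only [Set.mem_inter_iff, Set.mem_preimage, Set.mem_ofPred_eq, hfx, hbx, Left.neg_pos_iff]
    have e4 : volume (region T ∩ Metric.ball p r) + volume (region T ∩ Metric.ball p r) =
        volume (Metric.ball p r) := by
      nth_rewrite 1 [hae r]
      rw [e1, ← e3, e2, ← measure_union']
      · congr 1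
        ext x
        simp only [Set.mem_union, Set.mem_inter_iff, Set.mem_ofPred_eq]
        have := lt_or_ge (f x) 0
        tauto
      · rw [Set.disjoint_left]
        rintro x ⟨hx, -⟩ ⟨hx', -⟩
        exact not_lt.2 (show 0 ≤ f x from hx') hx
      · exact ((isOpen_lt (bary_continuous T i) continuous_const).inter
          Metric.isOpen_ball).measurableSet
    rw [hballvol r hr0] at e4
    have hl : localAngle T p = Real.pi := by
      simp only [localAngle, Fin.sum_univ_three, weight_of_mem_side h1 h2 h3]
      rw [← ang_sum T]; push_cast; ring
    have hfin : volume (region T ∩ Metric.ball p r) ≠ ⊤ :=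
      measure_ne_top_of_subset Set.inter_subset_right measure_ball_lt_top.ne
    rw [hl, ← ENNReal.ofReal_toReal hfin]
    congr 1
    have := congrArg ENNReal.toReal e4
    rw [ENNReal.toReal_add hfin hfin, ENNReal.toReal_ofReal (by positivity)] at this
    linarith

/-! ### Angle sums in a dissection -/

section

/-- The triangles `T i` dissect `D`, congruent or not. -/
structure IsDissection (D : Tri) {m : ℕ} (T : Fin m → Tri) : Prop where
  iUnion_eq : (⋃ i, region (T i)) = region D
  disjoint_interior : ∀ i j, i ≠ j → Disjoint (interior (region (T i))) (interior (region (T j)))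

variable {D : Tri} {m : ℕ} {T : Fin m → Tri}

lemma localAngle_nonneg (T : Tri) (p : Plane) : 0 ≤ localAngle T p :=
  Finset.sum_nonneg fun k _ => mul_nonneg (Nat.cast_nonneg _) (ang_pos T k).le

lemma IsDissection.subset (h : IsDissection D T) (i : Fin m) : region (T i) ⊆ region D := by
  rw [← h.iUnion_eq]; exact Set.subset_iUnion (fun i => region (T i)) i

lemma aedisjoint_region (h : IsDissection D T) {i j : Fin m} (hij : i ≠ j) :
    AEDisjoint volume (region (T i)) (region (T j)) :=
  (h.disjoint_interior i j hij).aedisjoint.congr (interior_region_ae_eq _).symm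
    (interior_region_ae_eq _).symm

/-- The angles under which the tiles are seen from a point add up to that of the dissected
triangle: compare areas in a small disc. -/
theorem sum_localAngle (h : IsDissection D T) (p : Plane) :
    ∑ i, localAngle (T i) p = localAngle D p := by
  have hpos : ∀ᶠ r in 𝓝[>] (0 : ℝ), 0 < r := self_mem_nhdsWithin
  obtain ⟨r, hD, hT, hr⟩ := ((eventually_volume_inter_ball D p).and
    ((eventually_all.2 fun i => eventually_volume_inter_ball (T i) p).and hpos)).exists
  have hsum : volume (region D ∩ Metric.ball p r) =
      ∑ i, volume (region (T i) ∩ Metric.ball p r) := by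
    rw [← h.iUnion_eq, Set.iUnion_inter, measure_iUnion₀, tsum_fintype]
    · intro i j hij
      exact (aedisjoint_region h hij).mono Set.inter_subset_left Set.inter_subset_left
    · intro i
      exact ((isClosed_region _).measurableSet.inter measurableSet_ball).nullMeasurableSet
  rw [hD] at hsum
  simp only [hT] at hsum
  have hnn : ∀ i, 0 ≤ localAngle (T i) p * r ^ 2 / 2 := fun i => by
    have := localAngle_nonneg (T i) p
    positivity
  rw [← ENNReal.ofReal_sum_of_nonneg fun i _ => hnn i,
    ENNReal.ofReal_eq_ofReal_iff (by have := localAngle_nonneg D p; positivity)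
    (Finset.sum_nonneg fun i _ => hnn i), ← Finset.sum_div, ← Finset.sum_mul] at hsum
  have hr2 : r ^ 2 ≠ 0 := by positivity
  field_simp at hsum
  exact hsum.symm

/-- Angles of a triangle that satisfy no linear relation over `ℚ`. -/
def AnglesIndependent (D : Tri) : Prop :=
  ∀ q : Fin 3 → ℚ, ∑ k, (q k : ℝ) * ang D k = 0 → q = 0

/-- If the tiles have the angles of `D`, vertex by vertex, and these are independent, then
each angle separately adds up. -/
theorem sum_weight (h : IsDissection D T) (hang : ∀ i k, ang (T i) k = ang D k)
    (hind : AnglesIndependent D) (p : Plane) (k : Fin 3) :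
    ∑ i, weight (T i) p k = weight D p k := by
  have hs := sum_localAngle h p
  simp only [localAngle, hang] at hs
  rw [Finset.sum_comm] at hs
  have := hind (fun k => ((∑ i, weight (T i) p k : ℕ) : ℚ) - (weight D p k : ℕ)) (by
    rw [← sub_eq_zero, ← Finset.sum_sub_distrib] at hs
    rw [← hs]
    refine Finset.sum_congr rfl fun k _ => ?_
    push_cast
    rw [sub_mul, Finset.sum_mul])
  have hk := congrFun this k
  simp only [Pi.zero_apply, sub_eq_zero] at hk
  exact_mod_cast hk

open Finset in
/-- Three angles with sum `π` that are combinations with natural coefficients of three angles with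
sum `π` agree with these up to order, provided that they are independent over `ℚ`. -/
theorem exists_perm_of_combination {a b : Fin 3 → ℝ} (P : Fin 3 → Fin 3 → ℕ)
    (hP : ∀ j, a j = ∑ k, (P j k : ℝ) * b k) (hsum : ∑ j, a j = ∑ k, b k)
    (hind : ∀ q : Fin 3 → ℚ, ∑ k, (q k : ℝ) * a k = 0 → q = 0) :
    ∃ τ : Equiv.Perm (Fin 3), ∀ j, a j = b (τ j) := by
  classical
  let M : Matrix (Fin 3) (Fin 3) ℚ := fun j k => P j k
  have hdet : M.det ≠ 0 := by
    intro h0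
    obtain ⟨v, hv, hvM⟩ := Matrix.exists_vecMul_eq_zero_iff.2 h0
    refine hv (hind v ?_)
    have hk : ∀ k, ∑ j, (v j : ℝ) * (P j k : ℝ) = 0 := fun k => by
      have := congrFun hvM k
      simp only [Matrix.vecMul, dotProduct, M, Pi.zero_apply] at this
      exact_mod_cast congrArg (Rat.cast : ℚ → ℝ) this
    simp only [hP, Finset.mul_sum]
    rw [Finset.sum_comm]
    refine Finset.sum_eq_zero fun k _ => ?_
    rw [← zero_mul (b k), ← hk k, Finset.sum_mul]
    exact Finset.sum_congr rfl fun j _ => by ring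
  -- `b` is a rational combination of `a`, hence independent as well
  have hindb : ∀ q : Fin 3 → ℚ, ∑ k, (q k : ℝ) * b k = 0 → q = 0 := by
    intro q hq
    have hMu : IsUnit M.det := isUnit_iff_ne_zero.2 hdet
    have hw : ∀ k, q k = ∑ j, Matrix.vecMul q M⁻¹ j * M j k := fun k => by
      have : Matrix.vecMul (Matrix.vecMul q M⁻¹) M = q := by
        rw [Matrix.vecMul_vecMul, Matrix.nonsing_inv_mul _ hMu, Matrix.vecMul_one]
      exact (congrFun this k).symm
    have h0 : Matrix.vecMul q M⁻¹ = 0 := by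
      apply hind
      rw [← hq]
      simp only [hP, Finset.mul_sum]
      rw [Finset.sum_comm]
      refine Finset.sum_congr rfl fun k _ => ?_
      rw [hw k]
      push_cast
      rw [Finset.sum_mul]
      exact Finset.sum_congr rfl fun j _ => by simp only [M]; push_cast; ring
    funext k
    rw [hw k, h0]; simp
  have hcol : ∀ k, ∑ j, P j k = 1 := by
    intro k
    have := hindb (fun k => ((∑ j, P j k : ℕ) : ℚ) - 1) (by
      simp only [hP] at hsum
      rw [Finset.sum_comm, ← sub_eq_zero, ← Finset.sum_sub_distrib] at hsum
      rw [← hsum]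
      refine Finset.sum_congr rfl fun k _ => ?_
      push_cast
      rw [sub_mul, Finset.sum_mul, one_mul])
    have hk := congrFun this k
    simp only [Pi.zero_apply, sub_eq_zero] at hk
    exact_mod_cast hk
  have hrow : ∀ j, ∃ k, P j k ≠ 0 := by
    intro j
    by_contra! hc
    have := hind (Pi.single j 1) (by
      have : a j = 0 := by rw [hP]; simp [hc]
      rw [Finset.sum_eq_single j] <;> simp +contextual [this])
    simpa using congrFun this j
  choose t ht using hrow
  have hle : ∀ i j k, i ≠ j → P i k ≠ 0 → P j k = 0 := by
    intro i j k hij hi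
    have h1 := hcol k
    have h2 : P i k + P j k ≤ ∑ j, P j k := by
      rw [← Finset.sum_pair (f := fun j => P j k) hij]
      exact Finset.sum_le_sum_of_subset (Finset.subset_univ _)
    omega
  have hinj : Function.Injective t := by
    intro i j hij
    by_contra hne
    exact ht j (by rw [← hij]; exact hle i j _ hne (ht i))
  let τ := Equiv.ofBijective t hinj.bijective_of_finite
  refine ⟨τ, fun j => ?_⟩
  rw [hP, Finset.sum_eq_single (t j)]
  · have h1 : P j (t j) = 1 := by
      have := hcol (t j)
      rwa [Finset.sum_eq_single j (fun i _ hi => hle j i _ hi.symm (ht j)) (by simp)] at this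
    rw [h1]; simp [τ]
  · intro k _ hk
    obtain ⟨i, rfl⟩ := hinj.bijective_of_finite.2 k
    rw [hle i j (t i) (by rintro rfl; exact hk rfl) (ht i)]; simp
  · simp

end

/-! ### The tiles are similar to the dissected triangle -/

section

open Pointwise

/-- The tiles `T i` dissect `D`, and each of them is a copy of `D` scaled by `ρ`, vertex `k` of the
tile corresponding to vertex `k` of `D`. -/
structure IsSimilarDissection (D : Tri) (ρ : ℝ) {m : ℕ} (T : Fin m → Tri) : Prop
    extends IsDissection D T where
  pos : 0 < ρ
  dist_eq : ∀ i j k, dist ((T i).points j) ((T i).points k) = ρ * dist (D.points j) (D.points k)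

variable {D : Tri} {m : ℕ} {T : Fin m → Tri}

lemma region_reindex (T : Tri) (e : Equiv.Perm (Fin 3)) :
    region (T.reindex e) = region T := by
  rw [region, Affine.Simplex.reindex_range_points, region]

lemma ang_reindex (T : Tri) (τ : Equiv.Perm (Fin 3)) (j : Fin 3) :
    ang (T.reindex τ.symm) j = ang T (τ j) := by
  have h : ∀ τ : Equiv.Perm (Fin 3), ∀ j, (τ (j + 1) = τ j + 1 ∧ τ (j + 2) = τ j + 2) ∨
      (τ (j + 1) = τ j + 2 ∧ τ (j + 2) = τ j + 1) := by decide
  simp only [ang, Affine.Simplex.reindex_points, Equiv.symm_symm, Function.comp_apply]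
  rcases h τ j with ⟨h1, h2⟩ | ⟨h1, h2⟩
  · rw [h1, h2]
  · rw [h1, h2, EuclideanGeometry.angle_comm]

lemma ang_congr {S T : Tri} (h : ∀ j k, dist (S.points j) (S.points k) =
    dist (T.points j) (T.points k)) (k : Fin 3) : ang S k = ang T k :=
  EuclideanGeometry.angle_eq_of_congruent (v₁ := S.points) (v₂ := T.points)
    (congruent_iff_dist_eq.2 h) _ _ _

lemma exists_dist_eq_of_ang_eq {S T : Tri} (h : ∀ k, ang S k = ang T k) :
    ∃ r : ℝ, 0 < r ∧ ∀ j k, dist (S.points j) (S.points k) =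
      r * dist (T.points j) (T.points k) := by
  have hsim : Similar ![S.points 0, S.points 1, S.points 2]
      ![T.points 0, T.points 1, T.points 2] := by
    apply EuclideanGeometry.similar_of_angle_angle
    · have e : ({S.points 0, S.points 1, S.points 2} : Set Plane) =
          {S.points (1 + 1), S.points 1, S.points (1 + 2)} := by
        change _ = ({S.points 2, S.points 1, S.points 0} : Set Plane)
        ext x; simp only [Set.mem_insert_iff, Set.mem_singleton_iff]; tauto
      rw [e]
      exact not_collinear_points S 1
    · have := h 1
      simp only [ang] at this
      rwa [EuclideanGeometry.angle_comm, EuclideanGeometry.angle_comm (T.points 0)]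
    · have := h 2
      simp only [ang] at this
      rwa [EuclideanGeometry.angle_comm, EuclideanGeometry.angle_comm (T.points 1)]
  obtain ⟨r, hr, hd⟩ := hsim.exists_pos_dist_eq
  refine ⟨r, hr, fun j k => ?_⟩
  have hv : ∀ T : Tri, ∀ i, ![T.points 0, T.points 1, T.points 2] i = T.points i := by
    intro T i; fin_cases i <;> rfl
  simpa only [hv] using hd j k

lemma ang_eq_of_dist {S T : Tri} {r : ℝ} (hr : 0 < r) (h : ∀ j k, dist (S.points j) (S.points k) =
    r * dist (T.points j) (T.points k)) (k : Fin 3) : ang S k = ang T k := by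
  have hsim : Similar ![S.points (k + 1), S.points k, S.points (k + 2)]
      ![T.points (k + 1), T.points k, T.points (k + 2)] := by
    have h' : Similar S.points T.points := similar_iff_exists_pos_dist_eq.2 ⟨r, hr, h⟩
    have := h'.index_map ![k + 1, k, k + 2]
    convert this using 1 <;> · ext i : 1; fin_cases i <;> rfl
  exact hsim.angle_eq

/-- The tiles of a dissection into congruent triangles are similar to the dissected triangle if the
angles of the latter are independent: at each corner, angles of the tiles add up to that of the
triangle. -/
theorem IsCongruentDissection.exists_similar (h : IsCongruentDissection D T)
    (hind : AnglesIndependent D) :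
    ∃ ρ : ℝ, ∃ T' : Fin m → Tri, IsSimilarDissection D ρ T' ∧
      ∀ i, region (T' i) = region (T i) := by
  obtain ⟨i₀⟩ : Nonempty (Fin m) := by
    have : D.points 0 ∈ ⋃ i, region (T i) := h.iUnion_eq ▸ points_mem_region D 0
    obtain ⟨i, -⟩ := Set.mem_iUnion.1 this
    exact ⟨i⟩
  choose σ hσ using fun i => h.congruent i i₀
  let T₁ : Fin m → Tri := fun i => (T i).reindex (σ i).symm
  have hreg₁ : ∀ i, region (T₁ i) = region (T i) := fun i => region_reindex _ _
  have hd₁ : ∀ i j k, dist ((T₁ i).points j) ((T₁ i).points k) =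
      dist ((T i₀).points j) ((T i₀).points k) := fun i j k => (hσ i).dist_eq j k
  have hdis₁ : IsDissection D T₁ :=
    ⟨by simp only [hreg₁, h.iUnion_eq], fun i j hij => by
      rw [hreg₁, hreg₁]; exact h.disjoint_interior i j hij⟩
  have hang₁ : ∀ i k, ang (T₁ i) k = ang (T i₀) k := fun i => ang_congr (hd₁ i)
  have hcomb : ∀ j, ang D j = ∑ k, ((∑ i, weight (T₁ i) (D.points j) k : ℕ) : ℝ) *
      ang (T i₀) k := by
    intro j
    have hs := sum_localAngle hdis₁ (D.points j)
    simp only [localAngle, hang₁] at hs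
    rw [Finset.sum_comm] at hs
    simp only [weight_points] at hs
    simp only [Nat.cast_ite, Nat.cast_one, Nat.cast_zero, ite_mul, one_mul, zero_mul,
      Finset.sum_ite_eq, Finset.mem_univ, if_true] at hs
    rw [← hs]
    refine Finset.sum_congr rfl fun k _ => ?_
    push_cast
    rw [Finset.sum_mul]
  obtain ⟨τ, hτ⟩ := exists_perm_of_combination _ hcomb
    (by rw [Fin.sum_univ_three, Fin.sum_univ_three, ang_sum, ang_sum]) hind
  let T₂ : Fin m → Tri := fun i => (T₁ i).reindex τ.symm
  have hreg₂ : ∀ i, region (T₂ i) = region (T i) := fun i => by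
    rw [← hreg₁]; exact region_reindex _ _
  have hang₂ : ∀ k, ang (T₂ i₀) k = ang D k := fun k => by
    rw [hτ k, ← hang₁ i₀]; exact ang_reindex _ _ _
  obtain ⟨ρ, hρ, hdist⟩ := exists_dist_eq_of_ang_eq hang₂
  refine ⟨ρ, T₂, ⟨⟨by simp only [hreg₂, h.iUnion_eq], fun i j hij => by
      rw [hreg₂, hreg₂]; exact h.disjoint_interior i j hij⟩, hρ, fun i j k => ?_⟩, hreg₂⟩
  rw [← hdist]
  exact (hd₁ i _ _).trans (hd₁ i₀ _ _).symm

lemma IsSimilarDissection.ang_eq {ρ : ℝ} (h : IsSimilarDissection D ρ T) (i : Fin m) (k : Fin 3) :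
    ang (T i) k = ang D k := ang_eq_of_dist h.pos (h.dist_eq i) k

lemma inner_sides (T : Tri) : inner ℝ (T.points 1 - T.points 0) (T.points 2 - T.points 0) =
    (dist (T.points 1) (T.points 0) ^ 2 + dist (T.points 2) (T.points 0) ^ 2 -
      dist (T.points 1) (T.points 2) ^ 2) / 2 := by
  rw [real_inner_eq_norm_mul_self_add_norm_mul_self_sub_norm_sub_mul_self_div_two,
    sub_sub_sub_cancel_right, ← dist_eq_norm, ← dist_eq_norm, ← dist_eq_norm]
  ring

theorem volume_region_of_dist {S T : Tri} {r : ℝ} (hr : 0 < r)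
    (h : ∀ j k, dist (S.points j) (S.points k) = r * dist (T.points j) (T.points k)) :
    volume (region S) = ENNReal.ofReal (r ^ 2) * volume (region T) := by
  -- the linear part of the affine map that sends the vertices of `T` to those of `S`
  let L : Plane →ₗ[ℝ] Plane :=
    ((bary T).coord 1).linear.smulRight (S.points 1 - S.points 0) +
      ((bary T).coord 2).linear.smulRight (S.points 2 - S.points 0)
  have hw : ∀ w : Plane, w = ((bary T).coord 1).linear w • (T.points 1 - T.points 0) +
      ((bary T).coord 2).linear w • (T.points 2 - T.points 0) := by
    intro w
    have hx := eq_vertex_add T 0 (T.points 0 + w)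
    have hc : ∀ j, j ≠ 0 → (bary T).coord j (T.points 0 + w) = ((bary T).coord j).linear w := by
      intro j hj
      rw [add_comm, ← vadd_eq_add, AffineMap.map_vadd, bary_coord_points, if_neg hj]; simp
    simp only [zero_add] at hx
    rw [hc 1 (by decide), hc 2 (by decide)] at hx
    exact add_left_cancel hx
  have hquad : ∀ (s t : ℝ) (u v : Plane), ‖s • u + t • v‖ ^ 2 =
      s ^ 2 * ‖u‖ ^ 2 + 2 * (s * t) * inner ℝ u v + t ^ 2 * ‖v‖ ^ 2 := by
    intro s t u v
    rw [norm_add_sq_real, norm_smul, norm_smul, real_inner_smul_left, real_inner_smul_right,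
      mul_pow, mul_pow, Real.norm_eq_abs, Real.norm_eq_abs, sq_abs, sq_abs]
    ring
  have hL : ∀ w, ‖L w‖ = r * ‖w‖ := by
    intro w
    rw [← sq_eq_sq₀ (norm_nonneg _) (by positivity), mul_pow]
    conv_rhs => rw [hw w]
    simp only [L, LinearMap.add_apply, LinearMap.smulRight_apply]
    rw [hquad, hquad, inner_sides, inner_sides, ← dist_eq_norm, ← dist_eq_norm, ← dist_eq_norm,
      ← dist_eq_norm, h, h, h]
    ring
  let I : Plane →ₗᵢ[ℝ] Plane := ⟨r⁻¹ • L, fun w => by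
    rw [LinearMap.smul_apply, norm_smul, hL, norm_inv, Real.norm_eq_abs, abs_of_pos hr]
    field_simp⟩
  let J : Plane ≃ₗᵢ[ℝ] Plane := I.toLinearIsometryEquiv rfl
  have hJ : ∀ w, r • J w = L w := fun w => by
    change r • (r⁻¹ • L) w = L w
    rw [LinearMap.smul_apply, smul_smul, mul_inv_cancel₀ hr.ne', one_smul]
  let f : Plane →ᵃ[ℝ] Plane := ⟨fun x => (S.points 0 - L (T.points 0)) + L x, L, fun p v => by
    simp only [vadd_eq_add, map_add]; abel⟩
  have hf : ∀ x, f x = (S.points 0 - L (T.points 0)) + L x := fun _ => rfl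
  have hfp : ∀ i, f (T.points i) = S.points i := by
    intro i
    have hLi : ∀ i, L (T.points i - T.points 0) = S.points i - S.points 0 := by
      intro i
      simp only [L, LinearMap.add_apply, LinearMap.smulRight_apply]
      rw [← vsub_eq_sub (T.points i), AffineMap.linearMap_vsub, AffineMap.linearMap_vsub]
      simp only [bary_coord_points]
      fin_cases i <;> simp
    rw [hf, sub_add_eq_add_sub, add_sub_assoc, ← map_sub, hLi]
    abel
  have hreg : region S = (fun x => (S.points 0 - L (T.points 0)) + x) '' (r • (J '' region T)) := by
    have : region S = f '' region T := by
      rw [region, region, AffineMap.image_convexHull]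
      congr 1
      rw [← Set.range_comp]
      congr 1
      funext i
      exact (hfp i).symm
    rw [this, ← Set.image_smul, Set.image_image, Set.image_image]
    simp only [hJ, hf]
  rw [hreg, Set.image_add_left, measure_preimage_add, Measure.addHaar_smul]
  congr 1
  · simp
  · rw [LinearIsometryEquiv.image_eq_preimage_symm]
    exact J.symm.measurePreserving.measure_preimage
      (isClosed_region T).measurableSet.nullMeasurableSet

lemma interior_region_nonempty (T : Tri) : (interior (region T)).Nonempty := by
  refine ⟨Finset.univ.centroid ℝ (bary T), mem_interior_region.2 fun i => ?_⟩
  rw [AffineBasis.coord_apply_centroid _ (Finset.mem_univ i)]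
  simp

lemma volume_region_ne_zero (T : Tri) : volume (region T) ≠ 0 :=
  ((isOpen_interior.measure_pos volume (interior_region_nonempty T)).trans_le
    (measure_mono interior_subset)).ne'

theorem IsSimilarDissection.card_mul_sq {ρ : ℝ} (h : IsSimilarDissection D ρ T) :
    (m : ℝ) * ρ ^ 2 = 1 := by
  have hv : volume (region D) = ∑ i, volume (region (T i)) := by
    rw [← h.iUnion_eq, measure_iUnion₀, tsum_fintype]
    · intro i j hij; exact aedisjoint_region h.toIsDissection hij
    · intro i; exact (isClosed_region _).measurableSet.nullMeasurableSet
  simp only [volume_region_of_dist h.pos (h.dist_eq _), Finset.sum_const, Finset.card_univ,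
    Fintype.card_fin, nsmul_eq_mul] at hv
  have h2 := congrArg ENNReal.toReal hv
  rw [ENNReal.toReal_mul, ENNReal.toReal_mul, ENNReal.toReal_ofReal (by positivity),
    ENNReal.toReal_natCast] at h2
  have h3 : (volume (region D)).toReal ≠ 0 :=
    (ENNReal.toReal_pos (volume_region_ne_zero D) (isCompact_region D).measure_lt_top.ne).ne'
  apply mul_right_cancel₀ h3
  linarith

end

/-! ### Independence of angles and sides -/

/-- The side of a triangle opposite to its vertex `k`. -/
noncomputable def side (T : Tri) (k : Fin 3) : ℝ := dist (T.points (k + 1)) (T.points (k + 2))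

/-- Sides of a triangle that satisfy no linear relation over `sqrtField`. -/
def SidesIndependent (D : Tri) : Prop :=
  ∀ q : Fin 3 → ℝ, (∀ k, q k ∈ sqrtField) → ∑ k, q k * side D k = 0 → q = 0

lemma side_pos (T : Tri) (k : Fin 3) : 0 < side T k :=
  dist_pos.2 (points_ne ((by decide : ∀ k : Fin 3, k + 1 ≠ k + 2) k))

lemma sin_ang_mul_side (T : Tri) :
    Real.sin (ang T 0) * side T 2 = Real.sin (ang T 2) * side T 0 ∧
      Real.sin (ang T 1) * side T 2 = Real.sin (ang T 2) * side T 1 := by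
  have h1 := EuclideanGeometry.law_sin (T.points 1) (T.points 2) (T.points 0)
  have h2 := EuclideanGeometry.law_sin (T.points 0) (T.points 2) (T.points 1)
  have a0 : ang T 0 = EuclideanGeometry.angle (T.points 1) (T.points 0) (T.points 2) := rfl
  have a1 : ang T 1 = EuclideanGeometry.angle (T.points 2) (T.points 1) (T.points 0) := rfl
  have a2 : ang T 2 = EuclideanGeometry.angle (T.points 0) (T.points 2) (T.points 1) := rfl
  have s0 : side T 0 = dist (T.points 1) (T.points 2) := rfl
  have s1 : side T 1 = dist (T.points 2) (T.points 0) := rfl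
  have s2 : side T 2 = dist (T.points 0) (T.points 1) := rfl
  rw [EuclideanGeometry.angle_comm (T.points 1) (T.points 2),
    EuclideanGeometry.angle_comm (T.points 0) (T.points 1), ← a1, ← a2] at h1
  rw [← a2, ← a0, dist_comm (T.points 1) (T.points 0), dist_comm (T.points 2)] at h2
  rw [s0, s1, s2]
  constructor
  · linarith
  · linarith

lemma shape_eq (D : Tri) : shape D = (side D 0 / side D 2, side D 1 / side D 2) := rfl

lemma shape_mem_triangleSpace (D : Tri) : shape D ∈ triangleSpace := by
  have h2 := side_pos D 2
  have key : ∀ k : Fin 3, side D k < side D (k + 1) + side D (k + 2) := by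
    intro k
    have h := dist_lt_dist_add_dist_iff.2 fun h => not_collinear_points D k (Wbtw.collinear h)
    have e : ∀ k : Fin 3, k + 1 + 1 = k + 2 ∧ k + 1 + 2 = k ∧ k + 2 + 1 = k ∧ k + 2 + 2 = k + 1 := by
      decide
    obtain ⟨e1, e2, e3, e4⟩ := e k
    simp only [side, e1, e2, e3, e4]
    rw [dist_comm (D.points (k + 1)) (D.points k), dist_comm (D.points k) (D.points (k + 2))] at h
    linarith
  have h3 : side D 2 ≠ 0 := h2.ne'
  have k0 := key 0
  have k1 := key 1
  have k2 := key 2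
  simp only [Fin.reduceAdd, zero_add] at k0 k1 k2
  simp only [triangleSpace, shape_eq, Set.mem_ofPred_eq, gt_iff_lt]
  refine ⟨?_, ?_, ?_⟩ <;> rw [← sub_pos]
  · have : side D 0 / side D 2 + 1 - side D 1 / side D 2 =
      (side D 0 + side D 2 - side D 1) / side D 2 := by field_simp
    rw [this]; apply div_pos _ h2; linarith
  · have : side D 1 / side D 2 + 1 - side D 0 / side D 2 =
      (side D 1 + side D 2 - side D 0) / side D 2 := by field_simp
    rw [this]; apply div_pos _ h2; linarith
  · have : side D 0 / side D 2 + side D 1 / side D 2 - 1 =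
      (side D 0 + side D 1 - side D 2) / side D 2 := by field_simp
    rw [this]; apply div_pos _ h2; linarith

lemma anglesIndependent_of_shape {D : Tri} (h : shape D ∉ exceptionalSet) :
    AnglesIndependent D := by
  intro q hq
  by_contra hne
  refine h ⟨Or.inl ⟨(ang D 0, ang D 1), ⟨⟨q 0, q 1, q 2, ?_, ?_⟩, ang_pos D 0, ang_pos D 1, ?_⟩, ?_⟩,
    shape_mem_triangleSpace D⟩
  · intro h0
    simp only [Prod.mk.injEq] at h0
    apply hne
    funext k
    fin_cases k
    exacts [h0.1, h0.2.1, h0.2.2]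
  · rw [Fin.sum_univ_three] at hq
    have : Real.pi - ang D 0 - ang D 1 = ang D 2 := by linarith [ang_sum D]
    rw [this, hq]
  · linarith [ang_sum D, ang_pos D 2]
  · have : Real.pi - ang D 0 - ang D 1 = ang D 2 := by linarith [ang_sum D]
    have hs := sin_ang_ne_zero D 2
    have h2 := (side_pos D 2).ne'
    obtain ⟨e1, e2⟩ := sin_ang_mul_side D
    simp only [shapeOfAngles, this, shape_eq]
    congr 1 <;> rw [div_eq_div_iff hs h2] <;> linarith

lemma sidesIndependent_of_shape {D : Tri} (h : shape D ∉ exceptionalSet) :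
    SidesIndependent D := by
  intro q hqK hq
  rw [Fin.sum_univ_three] at hq
  have h2 := (side_pos D 2).ne'
  by_cases h01 : q 0 = 0 ∧ q 1 = 0
  · rw [h01.1, h01.2] at hq
    have : q 2 = 0 := by simpa [h2] using hq
    funext k
    fin_cases k
    exacts [h01.1, h01.2, this]
  · refine absurd ⟨Or.inr ⟨q 0, hqK 0, q 1, hqK 1, q 2, hqK 2, ?_, ?_⟩, shape_mem_triangleSpace D⟩ h
    · simpa using h01
    · rw [shape_eq]
      field_simp
      linarith

/-! ### Walking along a line that no tile crosses -/

section

variable {D : Tri} {m : ℕ} {T : Fin m → Tri} {ρ : ℝ}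

lemma sum_of_distinct {l j k : Fin 3} (h1 : l ≠ j) (h2 : l ≠ k) (h3 : j ≠ k) (F : Fin 3 → ℝ) :
    F l + F j + F k = F 0 + F 1 + F 2 := by
  fin_cases l <;> fin_cases j <;> fin_cases k <;> simp_all <;> ring

lemma eq_of_distinct {l j k : Fin 3} (h1 : l ≠ j) (h2 : l ≠ k) (h3 : j ≠ k) (i : Fin 3) :
    i = l ∨ i = j ∨ i = k := by
  revert l j k i; decide

lemma affine_eq_sum (T : Tri) (f : Plane →ᵃ[ℝ] ℝ) (x : Plane) {l j k : Fin 3} (h1 : l ≠ j)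
    (h2 : l ≠ k) (h3 : j ≠ k) : f x = (bary T).coord l x * f (T.points l) +
      (bary T).coord j x * f (T.points j) + (bary T).coord k x * f (T.points k) := by
  rw [sum_of_distinct h1 h2 h3 (fun i => (bary T).coord i x * f (T.points i))]
  have hx := eq_vertex_add T 0 x
  simp only [zero_add] at hx
  have hs := bary_coord_sum T x
  conv_lhs => rw [hx]
  rw [add_comm, ← vadd_eq_add, AffineMap.map_vadd, map_add, map_smul, map_smul, ← vsub_eq_sub,
    ← vsub_eq_sub, AffineMap.linearMap_vsub, AffineMap.linearMap_vsub]
  simp only [vsub_eq_sub, smul_eq_mul, vadd_eq_add]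
  have : (bary T).coord 0 x = 1 - (bary T).coord 1 x - (bary T).coord 2 x := by linarith
  rw [this]; ring

lemma affine_add (f : Plane →ᵃ[ℝ] ℝ) (p v : Plane) : f (p + v) = f p + f.linear v := by
  rw [add_comm, ← vadd_eq_add, AffineMap.map_vadd, vadd_eq_add, add_comm]

lemma linear_eq_sum (T : Tri) (f : Plane →ᵃ[ℝ] ℝ) (v : Plane) {l j k : Fin 3} (h1 : l ≠ j)
    (h2 : l ≠ k) (h3 : j ≠ k) : f.linear v = ((bary T).coord l).linear v * f (T.points l) +
      ((bary T).coord j).linear v * f (T.points j) +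
      ((bary T).coord k).linear v * f (T.points k) := by
  have e1 := affine_eq_sum T f (0 + v) h1 h2 h3
  have e0 := affine_eq_sum T f 0 h1 h2 h3
  simp only [affine_add] at e1
  linarith

lemma bary_linear_sum (T : Tri) (v : Plane) {l j k : Fin 3} (h1 : l ≠ j)
    (h2 : l ≠ k) (h3 : j ≠ k) : ((bary T).coord l).linear v + ((bary T).coord j).linear v +
      ((bary T).coord k).linear v = 0 := by
  rw [sum_of_distinct h1 h2 h3 (fun i => ((bary T).coord i).linear v)]
  have e1 := bary_coord_sum T (0 + v)
  have e0 := bary_coord_sum T 0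
  simp only [affine_add] at e1
  linarith

lemma bary_linear_ne_zero (T : Tri) {u : Plane} (hu : u ≠ 0) {l j k : Fin 3} (h1 : l ≠ j)
    (h2 : l ≠ k) (h3 : j ≠ k) (hl : ((bary T).coord l).linear u = 0) :
    ((bary T).coord k).linear u ≠ 0 := by
  intro hk
  have hj : ((bary T).coord j).linear u = 0 := by
    have := bary_linear_sum T u h1 h2 h3
    linarith
  apply hu
  have : (0 : Plane) + u = 0 := bary_ext T fun i => by
    rw [affine_add]
    rcases eq_of_distinct h1 h2 h3 i with rfl | rfl | rfl <;> linarith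
  simpa using this

/-- The tile lies on the side `f ≥ 0` of the line `f = 0`. -/
def Above (f : Plane →ᵃ[ℝ] ℝ) (S : Tri) : Prop := ∀ x ∈ region S, 0 ≤ f x

/-- `p` is an inner point of a side of `S` that has the direction `u`. -/
def SidePasses (S : Tri) (u p : Plane) : Prop :=
  ∃ i, ((bary S).coord i).linear u = 0 ∧ (bary S).coord i p = 0 ∧
    ∀ j, j ≠ i → 0 < (bary S).coord j p

/-- The side of `S` from its vertex `j` to its vertex `k` runs from `p` to `p + s u`. -/
def SideFrom (S : Tri) (u p : Plane) (s : ℝ) (j k : Fin 3) : Prop :=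
  j ≠ k ∧ 0 < s ∧ S.points j = p ∧ S.points k = p + s • u

lemma SidePasses.mem_region {S : Tri} {u p : Plane} (h : SidePasses S u p) : p ∈ region S := by
  obtain ⟨i, -, h0, hj⟩ := h
  refine TriangleTiling.mem_region.2 fun j => ?_
  by_cases hji : j = i
  · rw [hji, h0]
  · exact (hj j hji).le

lemma SidePasses.ne_points {S : Tri} {u p : Plane} (h : SidePasses S u p) (l : Fin 3) :
    p ≠ S.points l := by
  rintro rfl
  obtain ⟨i, -, h0, hj⟩ := h
  rw [bary_coord_points] at h0
  have hl : l ≠ i := fun h => by simp [h] at h0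
  obtain ⟨k, hk1, hk2⟩ := (by decide : ∀ i l : Fin 3, ∃ k, k ≠ i ∧ k ≠ l) i l
  have := hj k hk1
  rw [bary_coord_points, if_neg hk2] at this
  exact lt_irrefl _ this

lemma SidePasses.weight {S : Tri} {u p : Plane} (h : SidePasses S u p) (k : Fin 3) :
    weight S p k = 1 := by
  refine weight_of_mem_side h.mem_region ?_ h.ne_points k
  rw [mem_interior_region]
  obtain ⟨i, -, h0, -⟩ := h
  exact fun h' => (h' i).ne' h0

/-- A side through `p` extends in both directions. -/
lemma SidePasses.eventually {S : Tri} {u p : Plane} (h : SidePasses S u p) :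
    ∀ᶠ ε in 𝓝 (0 : ℝ), p + ε • u ∈ region S := by
  obtain ⟨i, hi, h0, hj⟩ := h
  have : ∀ j, ∀ᶠ ε in 𝓝 (0 : ℝ), 0 ≤ (bary S).coord j (p + ε • u) := by
    intro j
    by_cases hji : j = i
    · refine Eventually.of_forall fun ε => ?_
      rw [affine_add, map_smul, hji, hi, h0]; simp
    · have hc : Continuous fun ε : ℝ => (bary S).coord j (p + ε • u) :=
        (bary_continuous S j).comp (by fun_prop)
      have h0 : 0 < (bary S).coord j (p + (0 : ℝ) • u) := by simpa using hj j hji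
      exact ((hc.tendsto 0).eventually_const_lt h0).mono fun _ h => h.le
  filter_upwards [eventually_all.2 this] with ε hε
  exact TriangleTiling.mem_region.2 hε

lemma eventually_quadratic_pos {c a b : ℝ} (h : 0 < c ∨ c = 0 ∧ 0 < a ∨ c = 0 ∧ a = 0 ∧ 0 < b) :
    ∀ᶠ ε in 𝓝[>] (0 : ℝ), 0 < c + (ε * a + ε ^ 2 * b) := by
  rcases h with h | ⟨rfl, h⟩ | ⟨rfl, rfl, h⟩
  · have hc : Continuous fun ε : ℝ => c + (ε * a + ε ^ 2 * b) := by fun_prop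
    exact (hc.continuousAt.eventually (lt_mem_nhds (by simpa using h))).filter_mono
      nhdsWithin_le_nhds
  · have hc : Continuous fun ε : ℝ => a + ε * b := by fun_prop
    filter_upwards [(hc.continuousAt.eventually (lt_mem_nhds (a := (0 : ℝ))
      (by simpa using h))).filter_mono nhdsWithin_le_nhds, self_mem_nhdsWithin] with ε hε hε0
    have hε0 : 0 < ε := hε0
    have : 0 + (ε * a + ε ^ 2 * b) = ε * (a + ε * b) := by ring
    rw [this]; positivity
  · filter_upwards [self_mem_nhdsWithin] with ε hε0
    have hε0 : 0 < ε := hε0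
    have : 0 + (ε * 0 + ε ^ 2 * b) = ε ^ 2 * b := by ring
    rw [this]; positivity

lemma eventually_quadratic_neg {c a b : ℝ} (h : c < 0 ∨ c = 0 ∧ a < 0 ∨ c = 0 ∧ a = 0 ∧ b < 0) :
    ∀ᶠ ε in 𝓝[>] (0 : ℝ), c + (ε * a + ε ^ 2 * b) < 0 := by
  have := eventually_quadratic_pos (c := -c) (a := -a) (b := -b) (by
    rcases h with h | ⟨h1, h⟩ | ⟨h1, h2, h⟩
    · left; linarith
    · right; left; constructor <;> linarith
    · right; right; refine ⟨?_, ?_, ?_⟩ <;> linarith)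
  filter_upwards [this] with ε hε
  nlinarith

lemma bary_quadratic (S : Tri) (i : Fin 3) (p u w : Plane) (ε : ℝ) :
    (bary S).coord i (p + (ε • u + ε ^ 2 • w)) = (bary S).coord i p +
      (ε * ((bary S).coord i).linear u + ε ^ 2 * ((bary S).coord i).linear w) := by
  rw [affine_add, map_add, map_smul, map_smul, smul_eq_mul, smul_eq_mul]

/-- If no tile crosses the line `f = 0` just after `p` in the direction `u`, some tile above this
line has a side on it that leaves `p` in the direction `u`. The nearby points
`p + ε u + ε ^ 2 w` above the line accumulate in one tile. -/
theorem exists_tile_along (h : IsDissection D T) {p u w : Plane} {f : Plane →ᵃ[ℝ] ℝ}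
    (hu : u ≠ 0) (hfp : f p = 0) (hfu : f.linear u = 0) (hfw : 0 < f.linear w)
    (hcov : ∀ᶠ ε in 𝓝[>] (0 : ℝ), p + (ε • u + ε ^ 2 • w) ∈ region D)
    (hbar : ∀ᶠ ε in 𝓝[>] (0 : ℝ), ∀ i, p + ε • u ∉ interior (region (T i))) :
    ∃ i, Above f (T i) ∧ (SidePasses (T i) u p ∨ ∃ j k s, SideFrom (T i) u p s j k) := by
  obtain ⟨i, hi⟩ : ∃ i, ∃ᶠ ε in 𝓝[>] (0 : ℝ), p + (ε • u + ε ^ 2 • w) ∈ region (T i) := by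
    by_contra! hc
    obtain ⟨ε, h1, h2⟩ := (hcov.and (eventually_all.2 hc)).exists
    rw [← h.iUnion_eq, Set.mem_iUnion] at h1
    obtain ⟨i, hi⟩ := h1
    exact h2 i hi
  set S := T i with hS
  have hnn : ∀ l, ¬ ((bary S).coord l p < 0 ∨
      (bary S).coord l p = 0 ∧ ((bary S).coord l).linear u < 0 ∨
      (bary S).coord l p = 0 ∧ ((bary S).coord l).linear u = 0 ∧
        ((bary S).coord l).linear w < 0) := by
    intro l hl
    obtain ⟨ε, h1, h2⟩ := (hi.and_eventually (eventually_quadratic_neg hl)).exists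
    rw [← bary_quadratic] at h2
    exact absurd (mem_region.1 h1 l) (not_le.2 h2)
  obtain ⟨l, hl0, hlu⟩ : ∃ l, (bary S).coord l p = 0 ∧ ((bary S).coord l).linear u = 0 := by
    by_contra! hc
    have hpos : ∀ l, ∀ᶠ ε in 𝓝[>] (0 : ℝ), 0 < (bary S).coord l (p + ε • u) := by
      intro l
      have hl := hnn l
      have := eventually_quadratic_pos (c := (bary S).coord l p)
        (a := ((bary S).coord l).linear u) (b := 0) (by
          push Not at hl
          rcases hl.1.lt_or_eq with h1 | h1
          · exact Or.inl h1
          · right; left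
            exact ⟨h1.symm, lt_of_le_of_ne (hl.2.1 h1.symm) (Ne.symm (hc l h1.symm))⟩)
      filter_upwards [this] with ε hε
      rw [affine_add, map_smul, smul_eq_mul]
      simpa using hε
    obtain ⟨ε, h1, h2⟩ := (hbar.and (eventually_all.2 hpos)).exists
    exact h1 i (mem_interior_region.2 h2)
  obtain ⟨j, k, hlj, hlk, hjk, hku⟩ : ∃ j k, l ≠ j ∧ l ≠ k ∧ j ≠ k ∧
      0 < ((bary S).coord k).linear u := by
    obtain ⟨j, k, h1, h2, h3⟩ :=
      (by decide : ∀ l : Fin 3, ∃ j k, l ≠ j ∧ l ≠ k ∧ j ≠ k) l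
    have hk := bary_linear_ne_zero S hu h1 h2 h3 hlu
    rcases lt_or_gt_of_ne hk with hk | hk
    · exact ⟨k, j, h2, h1, h3.symm, by have := bary_linear_sum S u h1 h2 h3; linarith⟩
    · exact ⟨j, k, h1, h2, h3, hk⟩
  have hsum := bary_linear_sum S u hlj hlk hjk
  have hju : ((bary S).coord j).linear u < 0 := by linarith
  have hjp : 0 < (bary S).coord j p := by
    have := hnn j
    push Not at this
    refine lt_of_le_of_ne this.1 fun h0 => ?_
    exact absurd (this.2.1 h0.symm) (not_le.2 hju)
  have hkp : 0 ≤ (bary S).coord k p := by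
    have := hnn k
    push Not at this
    exact this.1
  have hlw : 0 ≤ ((bary S).coord l).linear w := by
    have := hnn l
    push Not at this
    exact this.2.2 hl0 hlu
  have hp1 : (bary S).coord l p + (bary S).coord j p + (bary S).coord k p = 1 := by
    rw [sum_of_distinct hlj hlk hjk (fun i => (bary S).coord i p), bary_coord_sum]
  -- `f` is a positive multiple of the barycentric coordinate `l`
  have e1 := affine_eq_sum S f p hlj hlk hjk
  have e2 := linear_eq_sum S f u hlj hlk hjk
  have e3 := linear_eq_sum S f w hlj hlk hjk
  rw [hfp, hl0] at e1
  rw [hfu, hlu] at e2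
  have hjk' : f (S.points j) = f (S.points k) := by
    have hju' : ((bary S).coord j).linear u = - ((bary S).coord k).linear u := by linarith
    rw [hju'] at e2
    have : ((bary S).coord k).linear u * (f (S.points k) - f (S.points j)) = 0 := by linarith
    rcases mul_eq_zero.1 this with h0 | h0
    · exact absurd h0 hku.ne'
    · linarith
  have hfj : f (S.points j) = 0 := by
    rw [← hjk'] at e1
    have : ((bary S).coord j p + (bary S).coord k p) * f (S.points j) = 0 := by linarith
    have h1 : (bary S).coord j p + (bary S).coord k p = 1 := by linarith
    rwa [h1, one_mul] at this
  have hfk : f (S.points k) = 0 := by rw [← hjk', hfj]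
  rw [hfj, hfk] at e3
  have hfl : 0 < f (S.points l) := by
    by_contra! hc
    have : ((bary S).coord l).linear w * f (S.points l) ≤ 0 := mul_nonpos_of_nonneg_of_nonpos hlw hc
    linarith
  refine ⟨i, fun x hx => ?_, ?_⟩
  · rw [affine_eq_sum S f x hlj hlk hjk, hfj, hfk]
    have := mem_region.1 hx l
    have : 0 ≤ (bary S).coord l x * f (S.points l) := by positivity
    linarith
  · rcases hkp.lt_or_eq with hk | hk
    · left
      refine ⟨l, hlu, hl0, fun a ha => ?_⟩
      rcases eq_of_distinct hlj hlk hjk a with rfl | rfl | rfl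
      exacts [absurd rfl ha, hjp, hk]
    · right
      have hpj : S.points j = p := by
        refine bary_ext S fun a => ?_
        rw [bary_coord_points]
        rcases eq_of_distinct hlj hlk hjk a with rfl | rfl | rfl
        · rw [if_neg hlj, hl0]
        · rw [if_pos rfl]; linarith
        · rw [if_neg hjk.symm, ← hk]
      refine ⟨j, k, (((bary S).coord k).linear u)⁻¹, hjk, by positivity, hpj, ?_⟩
      refine bary_ext S fun a => ?_
      rw [bary_coord_points, affine_add, map_smul, smul_eq_mul]
      rcases eq_of_distinct hlj hlk hjk a with rfl | rfl | rfl
      · rw [if_neg hlk, hl0, hlu]; simp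
      · rw [if_neg hjk]
        have h1 : (bary S).coord a p = 1 := by linarith
        have h2 : ((bary S).coord a).linear u = - ((bary S).coord k).linear u := by linarith
        rw [h1, h2]; field_simp; ring
      · rw [if_pos rfl, ← hk]; field_simp; ring

lemma exists_third {j k : Fin 3} (h : j ≠ k) : ∃ l, l ≠ j ∧ l ≠ k := by
  revert j k; decide

lemma SideFrom.linear_eq {S : Tri} {u p : Plane} {s : ℝ} {j k : Fin 3}
    (h : SideFrom S u p s j k) (i : Fin 3) :
    s * ((bary S).coord i).linear u = (if i = k then 1 else 0) - (if i = j then 1 else 0) := by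
  obtain ⟨-, -, hj, hk⟩ := h
  have := affine_add ((bary S).coord i) p (s • u)
  rw [← hk, ← hj, bary_coord_points, bary_coord_points, map_smul, smul_eq_mul] at this
  linarith

/-- Points slightly above a side of a tile belong to its interior. -/
lemma SideFrom.eventually_mem_interior {S : Tri} {u w p : Plane} {s : ℝ} {j k : Fin 3}
    {f : Plane →ᵃ[ℝ] ℝ} (h : SideFrom S u p s j k) (hf : Above f S) (hfp : f p = 0)
    (hfu : f.linear u = 0) (hfw : 0 < f.linear w) :
    ∀ᶠ ε in 𝓝[>] (0 : ℝ), (p + s • u) + (ε • (-u) + ε ^ 2 • w) ∈ interior (region S) := by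
  obtain ⟨l, hlj, hlk⟩ := exists_third h.1
  have hl := h.linear_eq l
  have hj := h.linear_eq j
  rw [if_neg hlk, if_neg hlj, sub_self] at hl
  rw [if_neg h.1, if_pos rfl] at hj
  have hs := h.2.1
  have hlu : ((bary S).coord l).linear u = 0 := by
    rcases mul_eq_zero.1 hl with h0 | h0
    · exact absurd h0 hs.ne'
    · exact h0
  have hju : ((bary S).coord j).linear u < 0 := by
    by_contra! hc
    have : 0 ≤ s * ((bary S).coord j).linear u := by positivity
    linarith
  have hfj : f (S.points j) = 0 := by rw [h.2.2.1, hfp]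
  have hfk : f (S.points k) = 0 := by
    rw [h.2.2.2, affine_add, map_smul, hfu, hfp]; simp
  have hw := linear_eq_sum S f w hlj hlk h.1
  rw [hfj, hfk] at hw
  have hfl := hf _ (points_mem_region S l)
  have hlw : 0 < ((bary S).coord l).linear w := by
    by_contra! hc
    have := mul_nonpos_of_nonpos_of_nonneg hc hfl
    linarith
  have hpos : ∀ i, ∀ᶠ ε in 𝓝[>] (0 : ℝ),
      0 < (bary S).coord i ((p + s • u) + (ε • (-u) + ε ^ 2 • w)) := by
    intro i
    simp only [bary_quadratic]
    apply eventually_quadratic_pos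
    rw [← h.2.2.2, bary_coord_points, map_neg]
    rcases eq_of_distinct hlj hlk h.1 i with rfl | rfl | rfl
    · right; right
      exact ⟨if_neg hlk, by rw [hlu, neg_zero], hlw⟩
    · right; left
      exact ⟨if_neg h.1, by linarith⟩
    · left
      rw [if_pos rfl]; exact one_pos
  filter_upwards [eventually_all.2 hpos] with ε hε
  exact mem_interior_region.2 hε

lemma SidePasses.eventually_mem_interior {S : Tri} {u w p : Plane}
    {f : Plane →ᵃ[ℝ] ℝ} (h : SidePasses S u p) (hf : Above f S) (hfp : f p = 0)
    (hfw : 0 < f.linear w) :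
    ∀ᶠ ε in 𝓝[>] (0 : ℝ), p + (ε • (-u) + ε ^ 2 • w) ∈ interior (region S) := by
  obtain ⟨l, hlu, hl0, hl⟩ := h
  obtain ⟨j, k, hlj, hlk, hjk⟩ :=
    (by decide : ∀ l : Fin 3, ∃ j k, l ≠ j ∧ l ≠ k ∧ j ≠ k) l
  have hj0 := hl j hlj.symm
  have hk0 := hl k hlk.symm
  have e1 := affine_eq_sum S f p hlj hlk hjk
  have e3 := linear_eq_sum S f w hlj hlk hjk
  have hfl := hf _ (points_mem_region S l)
  have hfj := hf _ (points_mem_region S j)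
  have hfk := hf _ (points_mem_region S k)
  rw [hfp, hl0] at e1
  have hfj0 : f (S.points j) = 0 := by
    have h1 : 0 ≤ (bary S).coord k p * f (S.points k) := by positivity
    by_contra hne
    have : 0 < f (S.points j) := lt_of_le_of_ne hfj (Ne.symm hne)
    have : 0 < (bary S).coord j p * f (S.points j) := by positivity
    linarith
  have hfk0 : f (S.points k) = 0 := by
    by_contra hne
    have : 0 < f (S.points k) := lt_of_le_of_ne hfk (Ne.symm hne)
    have : 0 < (bary S).coord k p * f (S.points k) := by positivity
    rw [hfj0] at e1
    linarith
  rw [hfj0, hfk0] at e3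
  have hlw : 0 < ((bary S).coord l).linear w := by
    by_contra! hc
    have := mul_nonpos_of_nonpos_of_nonneg hc hfl
    linarith
  have hpos : ∀ i, ∀ᶠ ε in 𝓝[>] (0 : ℝ),
      0 < (bary S).coord i (p + (ε • (-u) + ε ^ 2 • w)) := by
    intro i
    simp only [bary_quadratic]
    apply eventually_quadratic_pos
    rcases eq_of_distinct hlj hlk hjk i with rfl | rfl | rfl
    · right; right
      exact ⟨hl0, by rw [map_neg, hlu, neg_zero], hlw⟩
    · exact Or.inl hj0
    · exact Or.inl hk0
  filter_upwards [eventually_all.2 hpos] with ε hε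
  exact mem_interior_region.2 hε

/-- Two tiles above the same line have no overlapping sides on it. -/
lemma not_sidePasses_of_sideFrom (h : IsDissection D T) {i i' : Fin m} {u w p : Plane} {s : ℝ}
    {j k : Fin 3} {f : Plane →ᵃ[ℝ] ℝ} (hfp : f p = 0)
    (hfu : f.linear u = 0) (hfw : 0 < f.linear w) (hi : Above f (T i))
    (hside : SideFrom (T i) u p s j k) (hi' : Above f (T i')) :
    ¬ SidePasses (T i') u (p + s • u) := by
  intro hpass
  by_cases hii : i = i'
  · subst hii
    exact hpass.ne_points k hside.2.2.2.symm
  · have hfp' : f (p + s • u) = 0 := by rw [affine_add, map_smul, hfu, hfp]; simp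
    obtain ⟨ε, h1, h2⟩ := ((hside.eventually_mem_interior hi hfp hfu hfw).and
      (hpass.eventually_mem_interior hi' hfp' hfw)).exists
    exact Set.disjoint_left.1 (h.disjoint_interior i i' hii) h1 h2

/-- The side of a similar tile is as long as its label says. -/
lemma IsSimilarDissection.sideFrom_length (h : IsSimilarDissection D ρ T) {i : Fin m}
    {u p : Plane} {s : ℝ} {j k l : Fin 3} (hs : SideFrom (T i) u p s j k) (hlj : l ≠ j)
    (hlk : l ≠ k) : s * ‖u‖ = ρ * side D l := by
  have h1 := h.dist_eq i k j
  rw [hs.2.2.1, hs.2.2.2, dist_eq_norm, add_sub_cancel_left, norm_smul, Real.norm_eq_abs,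
    abs_of_pos hs.2.1] at h1
  rw [h1]
  congr 1
  have := hs.1
  have key : ∀ l j k : Fin 3, l ≠ j → l ≠ k → j ≠ k → (k = l + 1 ∧ j = l + 2) ∨
      (k = l + 2 ∧ j = l + 1) := by decide
  rcases key l j k hlj hlk this with ⟨rfl, rfl⟩ | ⟨rfl, rfl⟩
  · rfl
  · rw [dist_comm]; rfl

/-- The segment from `X` to `X + τ u` on the line `f = 0` is not crossed by any tile, and the
dissected triangle extends above it (in the direction `w`). -/
structure IsBarrier (D : Tri) (T : Fin m → Tri) (f : Plane →ᵃ[ℝ] ℝ) (X u w : Plane) (τ : ℝ) :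
    Prop where
  ne_zero : u ≠ 0
  apply_eq : f X = 0
  linear_eq : f.linear u = 0
  linear_pos : 0 < f.linear w
  covered : ∀ t, 0 ≤ t → t < τ →
    ∀ᶠ ε in 𝓝[>] (0 : ℝ), (X + t • u) + (ε • u + ε ^ 2 • w) ∈ region D
  notMem : ∀ t, 0 < t → t < τ → ∀ i, X + t • u ∉ interior (region (T i))

lemma IsBarrier.apply_add {f : Plane →ᵃ[ℝ] ℝ} {X u w : Plane} {τ : ℝ}
    (hb : IsBarrier D T f X u w τ) (t : ℝ) : f (X + t • u) = 0 := by
  rw [affine_add, map_smul, hb.linear_eq, hb.apply_eq]; simp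

lemma SideFrom.sidePasses {S : Tri} {u p : Plane} {s t : ℝ} {j k : Fin 3}
    (h : SideFrom S u p s j k) (ht0 : 0 < t) (hts : t < s) : SidePasses S u (p + t • u) := by
  obtain ⟨l, hlj, hlk⟩ := exists_third h.1
  have hs := h.2.1
  have hlin : ∀ i, ((bary S).coord i).linear u =
      ((if i = k then 1 else 0) - (if i = j then 1 else 0)) / s := fun i => by
    rw [← h.linear_eq i]; field_simp
  have hval : ∀ i, (bary S).coord i (p + t • u) = (if i = j then 1 else 0) +
      t * (((if i = k then 1 else 0) - (if i = j then 1 else 0)) / s) := fun i => by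
    rw [affine_add, map_smul, smul_eq_mul, hlin, ← h.2.2.1, bary_coord_points]
  refine ⟨l, ?_, ?_, fun a ha => ?_⟩
  · rw [hlin, if_neg hlk, if_neg hlj]; simp
  · rw [hval, if_neg hlk, if_neg hlj]; simp
  · rw [hval]
    rcases eq_of_distinct hlj hlk h.1 a with rfl | rfl | rfl
    · exact absurd rfl ha
    · rw [if_pos rfl, if_neg h.1]
      have : t / s < 1 := (div_lt_one hs).2 hts
      have : 1 + t * ((0 - 1) / s) = 1 - t / s := by ring
      rw [this]; linarith
    · rw [if_pos rfl, if_neg h.1.symm]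
      have : 0 + t * ((1 - 0) / s) = t / s := by ring
      rw [this]; positivity

/-- One step of the walk along a barrier: a side that starts at `X + t u`. -/
lemma IsBarrier.exists_side (h : IsDissection D T) {f : Plane →ᵃ[ℝ] ℝ} {X u w : Plane} {τ t : ℝ}
    (hb : IsBarrier D T f X u w τ) (ht0 : 0 ≤ t) (ht : t < τ)
    (hstart : ∀ i, Above f (T i) → ¬ SidePasses (T i) u (X + t • u)) :
    ∃ i j k s, Above f (T i) ∧ SideFrom (T i) u (X + t • u) s j k ∧
      ∀ i', Above f (T i') → ¬ SidePasses (T i') u (X + (t + s) • u) := by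
  have hbar : ∀ᶠ ε in 𝓝[>] (0 : ℝ), ∀ i, (X + t • u) + ε • u ∉ interior (region (T i)) := by
    filter_upwards [Ioo_mem_nhdsGT (sub_pos.2 ht)] with ε hε i
    rw [add_assoc, ← add_smul]
    exact hb.notMem _ (by linarith [hε.1]) (by linarith [hε.2]) i
  obtain ⟨i, hi, hp | ⟨j, k, s, hs⟩⟩ := exists_tile_along h hb.ne_zero (hb.apply_add t)
    hb.linear_eq hb.linear_pos (hb.covered t ht0 ht) hbar
  · exact absurd hp (hstart i hi)
  · refine ⟨i, j, k, s, hi, hs, fun i' hi' => ?_⟩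
    have := not_sidePasses_of_sideFrom h (hb.apply_add t) hb.linear_eq hb.linear_pos
      hi hs hi'
    rwa [add_assoc, ← add_smul] at this

/-- Along a barrier, sides of tiles follow each other up to its end, unless one of them passes this
end: the length of the barrier is a combination of the sides of the tiles. -/
theorem IsBarrier.length_eq (h : IsSimilarDissection D ρ T) {f : Plane →ᵃ[ℝ] ℝ} {X u w : Plane}
    {τ t : ℝ} (hb : IsBarrier D T f X u w τ) (ht0 : 0 ≤ t) (ht : t ≤ τ)
    (hstart : ∀ i, Above f (T i) → ¬ SidePasses (T i) u (X + t • u))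
    (hend : ∀ i, Above f (T i) → ¬ SidePasses (T i) u (X + τ • u)) :
    ∃ c : Fin 3 → ℕ, (τ - t) * ‖u‖ = ∑ k, c k * (ρ * side D k) := by
  obtain ⟨δ, hδ, hδs⟩ : ∃ δ : ℝ, 0 < δ ∧ ∀ k, δ ≤ ρ * side D k := by
    have hp : ∀ k, 0 < ρ * side D k := fun k => mul_pos h.pos (side_pos D k)
    refine ⟨min (ρ * side D 0) (min (ρ * side D 1) (ρ * side D 2)), by
      simp only [lt_min_iff]; exact ⟨hp 0, hp 1, hp 2⟩, fun k => ?_⟩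
    fin_cases k <;> simp
  obtain ⟨N, hN⟩ := exists_nat_ge ((τ - t) * ‖u‖ / δ)
  rw [div_le_iff₀ hδ] at hN
  induction N generalizing t with
  | zero =>
    have hu : 0 < ‖u‖ := norm_pos_iff.2 hb.ne_zero
    refine ⟨0, ?_⟩
    have : 0 ≤ (τ - t) * ‖u‖ := mul_nonneg (by linarith) hu.le
    simp only [Nat.cast_zero, zero_mul] at hN
    rw [le_antisymm hN this]; simp
  | succ N ih =>
    rcases ht.lt_or_eq with ht' | rfl
    swap
    · exact ⟨0, by simp⟩
    obtain ⟨i, j, k, s, hi, hs, hnext⟩ := hb.exists_side h.toIsDissection ht0 ht' hstart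
    have hts : t + s ≤ τ := by
      by_contra! hc
      apply hend i hi
      have := hs.sidePasses (t := τ - t) (by linarith) (by linarith)
      rwa [add_assoc, ← add_smul, add_sub_cancel] at this
    obtain ⟨l, hlj, hlk⟩ := exists_third hs.1
    have hlen := h.sideFrom_length hs hlj hlk
    obtain ⟨c, hc⟩ := ih (t := t + s) (by linarith [hs.2.1]) hts hnext (by
      have := hδs l
      push_cast at hN
      nlinarith)
    refine ⟨c + Pi.single l 1, ?_⟩
    have e : (τ - t) * ‖u‖ = (τ - (t + s)) * ‖u‖ + s * ‖u‖ := by ring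
    rw [e, hc, hlen]
    simp only [Pi.add_apply, Nat.cast_add, add_mul, Finset.sum_add_distrib]
    congr 1
    rw [Finset.sum_eq_single l]
    · simp
    · intro b _ hb; simp [hb]
    · simp

end

/-! ### The number of tiles is a square -/

section

variable {D : Tri} {m : ℕ} {T : Fin m → Tri} {ρ : ℝ}

lemma IsDissection.interior_subset (h : IsDissection D T) (i : Fin m) :
    interior (region (T i)) ⊆ interior (region D) := interior_mono (h.subset i)

/-- A triangle is the closure of its interior, so a tile that meets the interior of another tile
would overlap with it. -/
lemma IsDissection.eq_of_mem_interior (h : IsDissection D T) {i j : Fin m} {p : Plane}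
    (hi : p ∈ interior (region (T i))) (hj : p ∈ region (T j)) : i = j := by
  by_contra hij
  have hcl : p ∈ closure (interior (region (T j))) := by
    rwa [(convex_region (T j)).closure_interior_eq_closure_of_nonempty_interior
      (interior_region_nonempty _), (isClosed_region _).closure_eq]
  obtain ⟨x, hx1, hx2⟩ := mem_closure_iff.1 hcl _ isOpen_interior hi
  exact Set.disjoint_left.1 (h.disjoint_interior i j hij) hx1 hx2

lemma weight_le_of_sum {p : Plane} {k : Fin 3} (hw : ∑ i, weight (T i) p k = weight D p k)
    (s : Finset (Fin m)) : ∑ i ∈ s, weight (T i) p k ≤ weight D p k := by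
  rw [← hw]; exact Finset.sum_le_sum_of_subset (Finset.subset_univ s)

lemma sum_side_inj (hs : SidesIndependent D) (c d : Fin 3 → ℕ)
    (h : ∑ k, (c k : ℝ) * side D k = ∑ k, (d k : ℝ) * side D k) : c = d := by
  have := hs (fun k => (c k : ℝ) - d k)
    (fun k => sqrtField.sub_mem (natCast_mem _ _) (natCast_mem _ _)) (by
      simp only [sub_mul, Finset.sum_sub_distrib, h, sub_self])
  funext k
  have hk := congrFun this k
  simp only [Pi.zero_apply, sub_eq_zero] at hk
  exact_mod_cast hk

/-- The sides of the tiles along `AB` have to be of the type `AB`. -/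
theorem IsSimilarDissection.exists_ratio (h : IsSimilarDissection D ρ T)
    (hang : AnglesIndependent D) (hside : SidesIndependent D) :
    ∃ n : ℕ, 0 < n ∧ m = n ^ 2 ∧ ρ = 1 / n := by
  have hw := sum_weight h.toIsDissection h.ang_eq hang
  have hlin : ∀ i j : Fin 3, ((bary D).coord i).linear (D.points j - D.points 0) =
      (if i = j then 1 else 0) - (if i = 0 then 1 else 0) := fun i j => by
    rw [← vsub_eq_sub, AffineMap.linearMap_vsub, bary_coord_points, bary_coord_points, vsub_eq_sub]
  have hb : IsBarrier D T ((bary D).coord 2) (D.points 0) (D.points 1 - D.points 0)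
      (D.points 2 - D.points 0) 1 := by
    refine ⟨sub_ne_zero.2 (points_ne (by decide)), ?_, ?_, ?_, ?_, ?_⟩
    · simp [bary_coord_points]
    · rw [hlin]; simp
    · rw [hlin]; simp
    · intro t ht0 ht
      have h0 := eventually_quadratic_pos (c := 1 - t) (a := -1) (b := -1) (Or.inl (by linarith))
      filter_upwards [h0, self_mem_nhdsWithin] with ε hε hε0
      have hε0 : 0 < ε := hε0
      refine mem_region.2 fun i => ?_
      rw [bary_quadratic, affine_add, map_smul, hlin, hlin, bary_coord_points]
      fin_cases i
      · simp; nlinarith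
      · simp; linarith
      · simp; positivity
    · intro t ht0 ht i hi
      have := mem_interior_region.1 (h.toIsDissection.interior_subset i hi) 2
      rw [affine_add, map_smul, hlin, bary_coord_points] at this
      simp at this
  have hstart : ∀ i, Above ((bary D).coord 2) (T i) →
      ¬ SidePasses (T i) (D.points 1 - D.points 0)
        (D.points 0 + (0 : ℝ) • (D.points 1 - D.points 0)) := by
    intro i _ hp
    rw [zero_smul, add_zero] at hp
    have h1 := weight_le_of_sum (hw (D.points 0) 1) {i}
    rw [Finset.sum_singleton, hp.weight, weight_points] at h1
    simp at h1
  have hend : ∀ i, Above ((bary D).coord 2) (T i) →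
      ¬ SidePasses (T i) (D.points 1 - D.points 0)
        (D.points 0 + (1 : ℝ) • (D.points 1 - D.points 0)) := by
    intro i _ hp
    rw [one_smul, add_sub_cancel] at hp
    have h1 := weight_le_of_sum (hw (D.points 1) 0) {i}
    rw [Finset.sum_singleton, hp.weight, weight_points] at h1
    simp at h1
  obtain ⟨c, hc⟩ := hb.length_eq h le_rfl zero_le_one hstart hend
  have hlen : ‖D.points 1 - D.points 0‖ = side D 2 := by
    rw [← dist_eq_norm, dist_comm]; rfl
  rw [hlen, sub_zero, one_mul] at hc
  have hcard := h.card_mul_sq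
  have hρ : ρ = (Real.sqrt m)⁻¹ := by
    have hm : (0 : ℝ) < m := by
      by_contra! hm0
      nlinarith [sq_nonneg ρ]
    have hs : 0 < Real.sqrt m := Real.sqrt_pos.2 hm
    refine eq_inv_of_mul_eq_one_left ?_
    rw [← sq_eq_sq₀ (by have := h.pos; positivity) zero_le_one,
      mul_pow, Real.sq_sqrt hm.le, one_pow]
    linarith
  have hρK : ρ ∈ sqrtField := by
    rw [hρ]
    exact sqrtField.inv_mem (Subfield.subset_closure ⟨m, rfl⟩)
  have hq := hside (fun k => c k * ρ - if k = 2 then 1 else 0)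
    (fun k => sqrtField.sub_mem (sqrtField.mul_mem (natCast_mem _ _) hρK)
      (by split_ifs <;> simp [one_mem, zero_mem])) (by
      simp only [sub_mul, Finset.sum_sub_distrib, ite_mul, one_mul, zero_mul, Finset.sum_ite_eq',
        Finset.mem_univ, if_true, sub_eq_zero]
      rw [hc]
      exact Finset.sum_congr rfl fun k _ => by ring)
  have h2 : (c 2 : ℝ) * ρ = 1 := by
    have := congrFun hq 2
    simpa [sub_eq_zero] using this
  have hc0 : (c 2 : ℝ) ≠ 0 := by rintro h0; rw [h0] at h2; simp at h2
  have hρ' : ρ = 1 / (c 2 : ℝ) := by field_simp; linarith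
  refine ⟨c 2, Nat.pos_of_ne_zero (by exact_mod_cast hc0), ?_, hρ'⟩
  have : (m : ℝ) = (c 2 : ℝ) ^ 2 := by
    rw [hρ'] at hcard
    field_simp at hcard
    linarith
  exact_mod_cast this

end

/-! ### Lattice coordinates -/

section

section Coordinates

variable (D : Tri) (n : ℕ)

/-- The vector with coordinates `a`, `b` with respect to the `n`-th parts of the sides `AB`, `AC`. -/
noncomputable def latticeVec (a b : ℝ) : Plane :=
  (a / n) • (D.points 1 - D.points 0) + (b / n) • (D.points 2 - D.points 0)

/-- The point with real coordinates `x`, `y` in the lattice that subdivides `D`. -/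
noncomputable def latticePt (x y : ℝ) : Plane := D.points 0 + latticeVec D n x y

/-- The affine function with the value `a x + b y + c` at the point with coordinates `x`, `y`. -/
noncomputable def latticeFun (a b c : ℝ) : Plane →ᵃ[ℝ] ℝ :=
  (n * a) • (bary D).coord 1 + (n * b) • (bary D).coord 2 + AffineMap.const ℝ Plane c

end Coordinates

variable {D : Tri} {n : ℕ}

lemma latticePoint_eq (i j : ℕ) : latticePoint D n i j = latticePt D n i j := by
  rw [latticePoint, latticePt, latticeVec, add_assoc]

lemma smul_latticeVec (t a b : ℝ) : t • latticeVec D n a b = latticeVec D n (t * a) (t * b) := by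
  simp only [latticeVec, smul_add, smul_smul, mul_div_assoc]

lemma latticePt_add_vec (x y a b : ℝ) :
    latticePt D n x y + latticeVec D n a b = latticePt D n (x + a) (y + b) := by
  simp only [latticePt, latticeVec]; module

lemma latticePt_add (x y t a b : ℝ) :
    latticePt D n x y + t • latticeVec D n a b = latticePt D n (x + t * a) (y + t * b) := by
  rw [smul_latticeVec, latticePt_add_vec]

lemma latticePt_quadratic (x y ε a b a' b' : ℝ) :
    latticePt D n x y + (ε • latticeVec D n a b + ε ^ 2 • latticeVec D n a' b') =
      latticePt D n (x + ε * a + ε ^ 2 * a') (y + ε * b + ε ^ 2 * b') := by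
  rw [← add_assoc, latticePt_add, latticePt_add]

lemma latticePt_sub (x y x' y' : ℝ) :
    latticePt D n x y - latticePt D n x' y' = latticeVec D n (x - x') (y - y') := by
  rw [sub_eq_iff_eq_add', latticePt_add_vec]; congr 1 <;> ring

lemma bary_linear_latticeVec (i : Fin 3) (a b : ℝ) :
    ((bary D).coord i).linear (latticeVec D n a b) =
      a / n * ((if i = 1 then 1 else 0) - (if i = 0 then 1 else 0)) +
      b / n * ((if i = 2 then 1 else 0) - (if i = 0 then 1 else 0)) := by
  rw [latticeVec, map_add, map_smul, map_smul, ← vsub_eq_sub, ← vsub_eq_sub,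
    AffineMap.linearMap_vsub, AffineMap.linearMap_vsub]
  simp only [bary_coord_points, vsub_eq_sub, smul_eq_mul]

lemma bary_latticePt (i : Fin 3) (x y : ℝ) :
    (bary D).coord i (latticePt D n x y) = (if i = 0 then 1 else 0) +
      (x / n * ((if i = 1 then 1 else 0) - (if i = 0 then 1 else 0)) +
      y / n * ((if i = 2 then 1 else 0) - (if i = 0 then 1 else 0))) := by
  rw [latticePt, affine_add, bary_linear_latticeVec, bary_coord_points]

lemma latticeFun_latticePt (hn : 0 < n) (a b c x y : ℝ) :
    latticeFun D n a b c (latticePt D n x y) = a * x + b * y + c := by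
  have : (n : ℝ) ≠ 0 := by positivity
  simp [latticeFun, bary_latticePt]
  field_simp

lemma latticeFun_linear (hn : 0 < n) (a b c x y : ℝ) :
    (latticeFun D n a b c).linear (latticeVec D n x y) = a * x + b * y := by
  have h := affine_add (latticeFun D n a b c) (latticePt D n 0 0) (latticeVec D n x y)
  rw [latticePt_add_vec, latticeFun_latticePt hn, latticeFun_latticePt hn] at h
  linarith

lemma exists_eq_latticePt (hn : 0 < n) (p : Plane) : ∃ x y, p = latticePt D n x y := by
  have hn' : (n : ℝ) ≠ 0 := by positivity
  refine ⟨n * (bary D).coord 1 p, n * (bary D).coord 2 p, ?_⟩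
  have h := eq_vertex_add D 0 p
  simp only [zero_add] at h
  conv_lhs => rw [h]
  rw [latticePt, latticeVec, mul_div_cancel_left₀ _ hn', mul_div_cancel_left₀ _ hn']

lemma latticePt_inj (hn : 0 < n) {x y x' y' : ℝ} (h : latticePt D n x y = latticePt D n x' y') :
    x = x' ∧ y = y' := by
  have h1 := congrArg (latticeFun D n 1 0 0) h
  have h2 := congrArg (latticeFun D n 0 1 0) h
  rw [latticeFun_latticePt hn, latticeFun_latticePt hn] at h1 h2
  constructor <;> linarith

lemma latticeVec_ne_zero (hn : 0 < n) {a b : ℝ} (h : a ≠ 0 ∨ b ≠ 0) : latticeVec D n a b ≠ 0 := by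
  intro h0
  have : latticePt D n a b = latticePt D n 0 0 := by
    rw [latticePt, latticePt, h0]; simp [latticeVec]
  obtain ⟨h1, h2⟩ := latticePt_inj hn this
  tauto

lemma latticePt_mem_region (hn : 0 < n) {x y : ℝ} :
    latticePt D n x y ∈ region D ↔ 0 ≤ x ∧ 0 ≤ y ∧ x + y ≤ n := by
  have hn' : (0 : ℝ) < n := by positivity
  rw [mem_region, Fin.forall_fin_succ, Fin.forall_fin_succ, Fin.forall_fin_one]
  simp only [bary_latticePt]
  simp
  have e : 1 + (-(x / n) + -(y / n)) = (n - (x + y)) / n := by field_simp; ring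
  rw [e]
  constructor
  · rintro ⟨h0, h1, h2⟩
    have h0' := mul_nonneg h0 hn'.le
    have h1' := mul_nonneg h1 hn'.le
    have h2' := mul_nonneg h2 hn'.le
    rw [div_mul_cancel₀ _ hn'.ne'] at h0' h1' h2'
    exact ⟨h1', h2', by linarith⟩
  · rintro ⟨h1, h2, h0⟩
    exact ⟨div_nonneg (by linarith) hn'.le, by positivity, by positivity⟩

lemma latticePt_mem_interior (hn : 0 < n) {x y : ℝ} :
    latticePt D n x y ∈ interior (region D) ↔ 0 < x ∧ 0 < y ∧ x + y < n := by
  have hn' : (0 : ℝ) < n := by positivity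
  rw [mem_interior_region, Fin.forall_fin_succ, Fin.forall_fin_succ, Fin.forall_fin_one]
  simp only [bary_latticePt]
  simp
  have e : 1 + (-(x / n) + -(y / n)) = (n - (x + y)) / n := by field_simp; ring
  rw [e]
  constructor
  · rintro ⟨h0, h1, h2⟩
    have h0' := mul_pos h0 hn'
    have h1' := mul_pos h1 hn'
    have h2' := mul_pos h2 hn'
    rw [div_mul_cancel₀ _ hn'.ne'] at h0' h1' h2'
    exact ⟨h1', h2', by linarith⟩
  · rintro ⟨h1, h2, h0⟩
    exact ⟨div_pos (by linarith) hn', by positivity, by positivity⟩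

lemma points_eq_latticePt (hn : 0 < n) : D.points 0 = latticePt D n 0 0 ∧
    D.points 1 = latticePt D n n 0 ∧ D.points 2 = latticePt D n 0 n := by
  have hn' : (n : ℝ) ≠ 0 := by positivity
  refine ⟨?_, ?_, ?_⟩ <;> simp [latticePt, latticeVec, hn']

lemma norm_latticeVec (hn : 0 < n) :
    ‖latticeVec D n (-1) 1‖ = 1 / n * side D 0 ∧ ‖latticeVec D n 0 1‖ = 1 / n * side D 1 ∧
      ‖latticeVec D n 1 0‖ = 1 / n * side D 2 := by
  have hn' : (0 : ℝ) < n := by positivity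
  have hnorm : ∀ v : Plane, ‖(1 / n : ℝ) • v‖ = 1 / n * ‖v‖ := fun v => by
    rw [norm_smul, Real.norm_eq_abs, abs_of_pos (by positivity)]
  refine ⟨?_, ?_, ?_⟩
  · have : latticeVec D n (-1) 1 = (1 / n : ℝ) • (D.points 2 - D.points 1) := by
      rw [latticeVec]; module
    rw [this, hnorm, ← dist_eq_norm, dist_comm]; rfl
  · have : latticeVec D n 0 1 = (1 / n : ℝ) • (D.points 2 - D.points 0) := by
      rw [latticeVec]; module
    rw [this, hnorm, ← dist_eq_norm]; rfl
  · have : latticeVec D n 1 0 = (1 / n : ℝ) • (D.points 1 - D.points 0) := by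
      rw [latticeVec]; module
    rw [this, hnorm, ← dist_eq_norm, dist_comm]; rfl

/-- A triangle over the side from `(x, y)` to `(x + 1, y)` with the sides of the scaled copy of `D`
has the same apex as this copy, if it lies above. -/
lemma apex_unique (hn : 0 < n) {a b : ℝ} (hb : 0 < b)
    (h1 : ‖latticeVec D n a b‖ = ‖latticeVec D n 0 1‖)
    (h2 : ‖latticeVec D n (a - 1) b‖ = ‖latticeVec D n (-1) 1‖) : a = 0 ∧ b = 1 := by
  have hn' : (0 : ℝ) < n := by positivity
  obtain ⟨e, he⟩ : ∃ e, e = latticeVec D n 1 0 := ⟨_, rfl⟩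
  obtain ⟨f, hf⟩ : ∃ f, f = latticeVec D n 0 1 := ⟨_, rfl⟩
  have hv : ∀ s t, latticeVec D n s t = s • e + t • f := by
    intro s t
    rw [he, hf]; simp only [latticeVec]; module
  have hquad : ∀ s t : ℝ, ‖latticeVec D n s t‖ ^ 2 =
      s ^ 2 * ‖e‖ ^ 2 + 2 * (s * t) * inner ℝ e f + t ^ 2 * ‖f‖ ^ 2 := by
    intro s t
    rw [hv, norm_add_sq_real, norm_smul, norm_smul, real_inner_smul_left, real_inner_smul_right,
      mul_pow, mul_pow, Real.norm_eq_abs, Real.norm_eq_abs, sq_abs, sq_abs]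
    ring
  have hcs : inner ℝ e f ^ 2 < ‖e‖ ^ 2 * ‖f‖ ^ 2 := by
    have he0 : 0 < ‖e‖ := norm_pos_iff.2 (he ▸ latticeVec_ne_zero hn (by simp))
    have hf0 : 0 < ‖f‖ := norm_pos_iff.2 (hf ▸ latticeVec_ne_zero hn (by simp))
    have hang : InnerProductGeometry.angle e f = ang D 0 := by
      have e' : e = (1 / n : ℝ) • (D.points 1 - D.points 0) := by rw [he, latticeVec]; simp
      have f' : f = (1 / n : ℝ) • (D.points 2 - D.points 0) := by rw [hf, latticeVec]; simp
      rw [e', f', InnerProductGeometry.angle_smul_left_of_pos _ _ (by positivity),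
        InnerProductGeometry.angle_smul_right_of_pos _ _ (by positivity)]
      rfl
    have hs := sin_ang_ne_zero D 0
    have hcos : inner ℝ e f = ‖e‖ * ‖f‖ * Real.cos (ang D 0) := by
      rw [← hang, InnerProductGeometry.cos_angle]; field_simp
    have h3 : 0 < Real.sin (ang D 0) ^ 2 := by positivity
    have h4 := Real.sin_sq_add_cos_sq (ang D 0)
    have h5 : 0 < (‖e‖ * ‖f‖) ^ 2 := by positivity
    rw [hcos, mul_pow]
    nlinarith
  have q1 := congrArg (· ^ 2) h1
  have q2 := congrArg (· ^ 2) h2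
  simp only [hquad] at q1 q2
  have he0 : 0 < ‖e‖ ^ 2 := by
    have : 0 < ‖e‖ := norm_pos_iff.2 (he ▸ latticeVec_ne_zero hn (by simp))
    positivity
  generalize ‖e‖ ^ 2 = E at *
  generalize ‖f‖ ^ 2 = G at *
  generalize (inner ℝ e f : ℝ) = F at *
  have hlin : a * E + b * F = F := by linarith
  have hsq : (1 - b ^ 2) * (E * G - F ^ 2) = 0 := by
    linear_combination (-E) * q1 + (a * E + b * F + F) * hlin
  have hb1 : b = 1 := by
    rcases mul_eq_zero.1 hsq with h | h
    · nlinarith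
    · linarith
  subst hb1
  refine ⟨?_, rfl⟩
  have : a * E = 0 := by linarith
  rcases mul_eq_zero.1 this with h | h
  · exact h
  · linarith

end

/-! ### Tiles in lattice position -/

section

variable {D : Tri} {n m : ℕ} {T : Fin m → Tri}

/-- A dissection into tiles similar to `D` with ratio `1 / n`, for which the angles add up
separately at each point and the sides satisfy no integral relation. -/
structure IsLatticeDissection (D : Tri) (n : ℕ) {m : ℕ} (T : Fin m → Tri) : Prop
    extends IsSimilarDissection D (1 / n) T where
  n_pos : 0 < n
  sum_weight : ∀ p k, ∑ i, weight (T i) p k = weight D p k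
  side_inj : ∀ c d : Fin 3 → ℕ,
    ∑ k, (c k : ℝ) * side D k = ∑ k, (d k : ℝ) * side D k → c = d

/-- The triangle with the vertices `(x, y)`, `(x + 1, y)`, `(x, y + 1)`. -/
def IsUp (D : Tri) (n : ℕ) (S : Tri) (x y : ℝ) : Prop :=
  S.points 0 = latticePt D n x y ∧ S.points 1 = latticePt D n (x + 1) y ∧
    S.points 2 = latticePt D n x (y + 1)

/-- The triangle with the vertices `(x + 1, y + 1)`, `(x, y + 1)`, `(x + 1, y)`. -/
def IsDown (D : Tri) (n : ℕ) (S : Tri) (x y : ℝ) : Prop :=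
  S.points 0 = latticePt D n (x + 1) (y + 1) ∧ S.points 1 = latticePt D n x (y + 1) ∧
    S.points 2 = latticePt D n (x + 1) y

/-- Some tile is the upright lattice triangle at `(x, y)`. -/
def HasUp (D : Tri) (n : ℕ) (T : Fin m → Tri) (x y : ℝ) : Prop := ∃ i, IsUp D n (T i) x y

/-- Some tile is the inverted lattice triangle at `(x, y)`. -/
def HasDown (D : Tri) (n : ℕ) (T : Fin m → Tri) (x y : ℝ) : Prop := ∃ i, IsDown D n (T i) x y

lemma le_of_forall_points {S : Tri} {f : Plane →ᵃ[ℝ] ℝ} {c : ℝ} (h : ∀ l, f (S.points l) ≤ c)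
    {q : Plane} (hq : q ∈ region S) : f q ≤ c := by
  have hq' := mem_region.1 hq
  have hs := bary_coord_sum S q
  rw [affine_eq_sum S f q (l := 0) (j := 1) (k := 2) (by decide) (by decide) (by decide)]
  have h0 := mul_le_mul_of_nonneg_left (h 0) (hq' 0)
  have h1 := mul_le_mul_of_nonneg_left (h 1) (hq' 1)
  have h2 := mul_le_mul_of_nonneg_left (h 2) (hq' 2)
  have : (bary S).coord 0 q * c + (bary S).coord 1 q * c + (bary S).coord 2 q * c = c := by
    rw [← add_mul, ← add_mul, hs, one_mul]
  linarith

namespace IsLatticeDissection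

lemma up_le (hn : 0 < n) {S : Tri} {x y a b c : ℝ} (h : IsUp D n S x y)
    (h0 : a * x + b * y ≤ c) (h1 : a * (x + 1) + b * y ≤ c) (h2 : a * x + b * (y + 1) ≤ c)
    {x' y' : ℝ} (hq : latticePt D n x' y' ∈ region S) : a * x' + b * y' ≤ c := by
  have := le_of_forall_points (f := latticeFun D n a b 0) (c := c) (S := S) (fun l => by
    fin_cases l
    · simp only [Fin.zero_eta]; rw [h.1, latticeFun_latticePt hn]; linarith
    · simp only [Fin.mk_one]; rw [h.2.1, latticeFun_latticePt hn]; linarith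
    · simp only [Fin.reduceFinMk]; rw [h.2.2, latticeFun_latticePt hn]; linarith) hq
  rw [latticeFun_latticePt hn] at this
  linarith

lemma down_le (hn : 0 < n) {S : Tri} {x y : ℝ} (h : IsDown D n S x y)
    {x' y' : ℝ} (hq : latticePt D n x' y' ∈ region S) : y' ≤ y + 1 := by
  have := le_of_forall_points (f := latticeFun D n 0 1 0) (c := y + 1) (S := S) (fun l => by
    fin_cases l
    · simp only [Fin.zero_eta]; rw [h.1, latticeFun_latticePt hn]; linarith
    · simp only [Fin.mk_one]; rw [h.2.1, latticeFun_latticePt hn]; linarith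
    · simp only [Fin.reduceFinMk]; rw [h.2.2, latticeFun_latticePt hn]; linarith) hq
  rw [latticeFun_latticePt hn] at this
  linarith

variable (h : IsLatticeDissection D n T)
include h

lemma weight_one_le {i : Fin m} {p : Plane} {k : Fin 3} (hi : 1 ≤ weight (T i) p k) :
    1 ≤ weight D p k := by
  have := weight_le_of_sum (h.sum_weight p k) {i}
  rw [Finset.sum_singleton] at this
  omega

lemma weight_two_le {i j : Fin m} {p : Plane} {k : Fin 3} (hij : i ≠ j)
    (hi : 1 ≤ weight (T i) p k) (hj : 1 ≤ weight (T j) p k) : 2 ≤ weight D p k := by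
  have := weight_le_of_sum (h.sum_weight p k) {i, j}
  rw [Finset.sum_pair hij] at this
  omega

lemma false_of_three {i j l : Fin m} {p : Plane} {k : Fin 3} (hij : i ≠ j) (hil : i ≠ l)
    (hjl : j ≠ l) (hi : 1 ≤ weight (T i) p k) (hj : 1 ≤ weight (T j) p k)
    (hl : 1 ≤ weight (T l) p k) : False := by
  have h1 := weight_le_of_sum (h.sum_weight p k) {i, j, l}
  rw [Finset.sum_insert (by simp [hij, hil]), Finset.sum_pair hjl] at h1
  have := weight_le_two D p k
  omega

lemma false_of_two {i j : Fin m} {p : Plane} {k : Fin 3} (hp : p ∉ interior (region D))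
    (hij : i ≠ j) (hi : 1 ≤ weight (T i) p k) (hj : 1 ≤ weight (T j) p k) : False := by
  have h1 := h.weight_two_le hij hi hj
  have := weight_le_one hp k
  omega

omit h in
lemma weight_vertex {S : Tri} {p : Plane} {k : Fin 3} (hp : S.points k = p) :
    1 ≤ weight S p k := by
  rw [← hp, weight_points, if_pos rfl]

/-- The sides of tiles are not crossed by other tiles. -/
lemma notMem_interior_of_mem_side {b : Fin m} {l l' : Fin 3} (hl : l ≠ l') {s : ℝ} (h0 : 0 ≤ s)
    (h1 : s ≤ 1) {q : Plane}
    (hq : q = (T b).points l + s • ((T b).points l' - (T b).points l)) (a : Fin m) :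
    q ∉ interior (region (T a)) := by
  intro ha
  have hc : ∀ i, (bary (T b)).coord i q = (if i = l then 1 else 0) +
      s * ((if i = l' then 1 else 0) - (if i = l then 1 else 0)) := by
    intro i
    rw [hq, affine_add, map_smul, ← vsub_eq_sub, AffineMap.linearMap_vsub]
    simp only [bary_coord_points, vsub_eq_sub, smul_eq_mul]
  have hmem : q ∈ region (T b) := mem_region.2 fun i => by
    rw [hc]; split_ifs <;> linarith
  by_cases hab : a = b
  · subst hab
    obtain ⟨k, hk, hk'⟩ := exists_third hl
    have := mem_interior_region.1 ha k
    rw [hc, if_neg hk, if_neg hk'] at this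
    simp at this
  · exact hab (h.eq_of_mem_interior ha hmem)

/-- If at the point `p` the label `k` occurs below the height `y`, or if `p` is on the boundary,
then it occurs at `p` at most once above. -/
lemma unique_above {p : Plane} {k : Fin 3} {y : ℝ}
    (hp : p ∉ interior (region D) ∨ ∃ b, 1 ≤ weight (T b) p k ∧
      ∀ x' y', latticePt D n x' y' ∈ region (T b) → y' ≤ y)
    {a a' : Fin m} (ha : 1 ≤ weight (T a) p k) (ha' : 1 ≤ weight (T a') p k)
    (hy : ∃ x' y', latticePt D n x' y' ∈ region (T a) ∧ y < y')
    (hy' : ∃ x' y', latticePt D n x' y' ∈ region (T a') ∧ y < y') : a = a' := by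
  by_contra hne
  obtain ⟨x₁, y₁, h1, h2⟩ := hy
  obtain ⟨x₂, y₂, h3, h4⟩ := hy'
  rcases hp with hp | ⟨b, hb, hle⟩
  · exact h.false_of_two hp hne ha ha'
  · refine h.false_of_three (i := a) (j := a') (l := b) hne ?_ ?_ ha ha' hb
    · rintro rfl; exact absurd (hle _ _ h1) (not_le.2 h2)
    · rintro rfl; exact absurd (hle _ _ h3) (not_le.2 h4)

end IsLatticeDissection

/-- The tiles below the height `j` are in lattice position, as far as they touch the segment from
`(0, j)` to `(k, j)`. -/
structure Foundation (D : Tri) (n : ℕ) (T : Fin m → Tri) (j k : ℕ) : Prop where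
  le : j + k ≤ n
  down : 1 ≤ j → ∀ i < k, HasDown D n T (i : ℝ) ((j : ℝ) - 1)
  up : 1 ≤ j → ∀ i ≤ k, HasUp D n T (i : ℝ) ((j : ℝ) - 1)

lemma Foundation.mono {j k k' : ℕ} (hf : Foundation D n T j k) (hk : k' ≤ k) :
    Foundation D n T j k' :=
  ⟨by have := hf.le; omega, fun hj i hi => hf.down hj i (by omega),
    fun hj i hi => hf.up hj i (by omega)⟩

namespace IsLatticeDissection

variable (h : IsLatticeDissection D n T)
include h

lemma notMem_interior_of_eq_zero {x y : ℝ} (hxy : x = 0 ∨ y = 0 ∨ x + y = n) :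
    latticePt D n x y ∉ interior (region D) := by
  rw [latticePt_mem_interior h.n_pos]
  rintro ⟨h1, h2, h3⟩
  rcases hxy with h | h | h <;> linarith

lemma eq_up_of_label_one {j k i : ℕ} (hf : Foundation D n T j k) (hi : i < k)
    (hup : 1 ≤ i → HasUp D n T ((i : ℝ) - 1) j) {a : Fin m}
    (ha : 1 ≤ weight (T a) (latticePt D n i j) 1)
    (hy : ∃ x' y', latticePt D n x' y' ∈ region (T a) ∧ (j : ℝ) < y') :
    1 ≤ i ∧ IsUp D n (T a) ((i : ℝ) - 1) j := by
  have hn := h.n_pos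
  have hdown : 1 ≤ j → ∃ b, 1 ≤ weight (T b) (latticePt D n i j) 1 ∧
      ∀ x' y', latticePt D n x' y' ∈ region (T b) → y' ≤ j := by
    intro hj
    obtain ⟨b, hb⟩ := hf.down hj i hi
    refine ⟨b, weight_vertex (by rw [hb.2.1, sub_add_cancel]), fun x' y' hm => ?_⟩
    have := down_le hn hb hm
    linarith
  rcases Nat.eq_zero_or_pos i with rfl | hi0
  · exfalso
    rcases Nat.eq_zero_or_pos j with rfl | hj0
    · have hA : latticePt D n ((0 : ℕ) : ℝ) ((0 : ℕ) : ℝ) = D.points 0 := by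
        rw [(points_eq_latticePt hn).1]; simp
      rw [hA] at ha
      have := h.weight_one_le ha
      rw [weight_points] at this
      simp at this
    · obtain ⟨b, hb, hle⟩ := hdown hj0
      refine h.false_of_two (h.notMem_interior_of_eq_zero (by simp)) (i := a) (j := b) ?_ ha hb
      rintro rfl
      obtain ⟨x', y', h1, h2⟩ := hy
      exact absurd (hle _ _ h1) (not_le.2 h2)
  · refine ⟨hi0, ?_⟩
    obtain ⟨c, hc⟩ := hup hi0
    have hac : a = c := by
      refine h.unique_above (p := latticePt D n i j) (k := 1) (y := j) ?_ ha ?_ hy ?_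
      · rcases Nat.eq_zero_or_pos j with rfl | hj0
        · exact Or.inl (h.notMem_interior_of_eq_zero (by simp))
        · exact Or.inr (hdown hj0)
      · exact weight_vertex (by rw [hc.2.1, sub_add_cancel])
      · exact ⟨_, _, hc.2.2 ▸ points_mem_region (T c) 2, by linarith⟩
    rw [hac]; exact hc

lemma eq_up_of_label_zero {j k i : ℕ} (hf : Foundation D n T j k) (hi : i ≤ k) (hi0 : 1 ≤ i)
    (hup : HasUp D n T i j) {a : Fin m}
    (ha : 1 ≤ weight (T a) (latticePt D n i j) 0)
    (hy : ∃ x' y', latticePt D n x' y' ∈ region (T a) ∧ (j : ℝ) < y') :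
    IsUp D n (T a) i j := by
  have hn := h.n_pos
  obtain ⟨c, hc⟩ := hup
  have hac : a = c := by
    refine h.unique_above (p := latticePt D n i j) (k := 0) (y := j) ?_ ha ?_ hy ?_
    · rcases Nat.eq_zero_or_pos j with rfl | hj0
      · exact Or.inl (h.notMem_interior_of_eq_zero (by simp))
      · obtain ⟨b, hb⟩ := hf.down hj0 (i - 1) (by omega)
        rw [Nat.cast_sub hi0, Nat.cast_one] at hb
        refine Or.inr ⟨b, weight_vertex (by rw [hb.1, sub_add_cancel, sub_add_cancel]),
          fun x' y' hm => ?_⟩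
        have := down_le hn hb hm
        linarith
    · exact weight_vertex hc.1
    · exact ⟨_, _, hc.2.2 ▸ points_mem_region (T c) 2, by linarith⟩
  rw [hac]; exact hc

lemma unique_label_two {j k i : ℕ} (hf : Foundation D n T j k) (hi : i ≤ k) {a a' : Fin m}
    (ha : 1 ≤ weight (T a) (latticePt D n i j) 2) (ha' : 1 ≤ weight (T a') (latticePt D n i j) 2)
    (hy : ∃ x' y', latticePt D n x' y' ∈ region (T a) ∧ (j : ℝ) < y')
    (hy' : ∃ x' y', latticePt D n x' y' ∈ region (T a') ∧ (j : ℝ) < y') : a = a' := by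
  have hn := h.n_pos
  refine h.unique_above (p := latticePt D n i j) (k := 2) (y := j) ?_ ha ha' hy hy'
  rcases Nat.eq_zero_or_pos j with rfl | hj0
  · exact Or.inl (h.notMem_interior_of_eq_zero (by simp))
  · obtain ⟨b, hb⟩ := hf.up hj0 i hi
    refine Or.inr ⟨b, weight_vertex (by rw [hb.2.2, sub_add_cancel]), fun x' y' hm => ?_⟩
    have := up_le hn hb (a := 0) (b := 1) (c := j) (by linarith) (by linarith) (by linarith) hm
    linarith

lemma side_length {i : Fin m} {u p : Plane} {s : ℝ} {j k l : Fin 3}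
    (hs : SideFrom (T i) u p s j k) (hlj : l ≠ j) (hlk : l ≠ k) :
    s * ‖u‖ = 1 / n * side D l :=
  h.toIsSimilarDissection.sideFrom_length hs hlj hlk

lemma unit_of_side_length {l : Fin 3} {u : Plane} {s : ℝ} (hu : ‖u‖ = 1 / n * side D l)
    (hs : s * ‖u‖ = 1 / n * side D l) : s = 1 := by
  have hn' : (0 : ℝ) < n := by exact_mod_cast h.n_pos
  have hpos : 0 < ‖u‖ := by rw [hu]; have := side_pos D l; positivity
  rw [← hu] at hs
  exact (mul_eq_right₀ hpos.ne').1 hs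

/-- A natural multiple of a side is a sum of sides, the first of which is known, only if this has
the same type. -/
lemma label_eq_of_length {l l' : Fin 3} {N : ℕ} {c : Fin 3 → ℕ} {x y : ℝ}
    (hx : x + y = N * (1 / n * side D l)) (h1 : x = 1 / n * side D l')
    (hc : y = ∑ k, c k * (1 / n * side D k)) : l' = l := by
  have hn' : (n : ℝ) ≠ 0 := by exact_mod_cast h.n_pos.ne'
  by_contra hne
  have := h.side_inj (Pi.single l' 1 + c) (Pi.single l N) (by
    have e : ∑ k, ((c k : ℝ) * (1 / n * side D k)) = 1 / n * ∑ k, (c k : ℝ) * side D k := by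
      rw [Finset.mul_sum]; exact Finset.sum_congr rfl fun k _ => by ring
    have e1 : ∀ (l : Fin 3) (N : ℕ), ∑ k, (((Pi.single l N : Fin 3 → ℕ) k : ℕ) : ℝ) * side D k =
        N * side D l := by
      intro l N
      rw [Finset.sum_eq_single l]
      · simp
      · intro b _ hb; simp [hb]
      · simp
    simp only [Pi.add_apply, Nat.cast_add, add_mul, Finset.sum_add_distrib]
    rw [e1, e1]
    rw [hc, e, h1] at hx
    field_simp at hx
    push_cast
    linarith)
  have h2 := congrFun this l'
  simp [hne] at h2

end IsLatticeDissection

end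

/-! ### Rows and gaps -/

section

variable {D : Tri} {n m : ℕ} {T : Fin m → Tri}

namespace IsLatticeDissection

variable (h : IsLatticeDissection D n T)
include h

lemma rowBarrier {j k : ℕ} (hf : Foundation D n T j k) :
    IsBarrier D T (latticeFun D n 0 1 (-j)) (latticePt D n 0 j) (latticeVec D n 1 0)
      (latticeVec D n 0 1) k := by
  have hn := h.n_pos
  have hjk : (j : ℝ) + k ≤ n := by exact_mod_cast hf.le
  refine ⟨latticeVec_ne_zero hn (by simp), ?_, ?_, ?_, ?_, ?_⟩
  · rw [latticeFun_latticePt hn]; ring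
  · rw [latticeFun_linear hn]; ring
  · rw [latticeFun_linear hn]; norm_num
  · intro t ht0 ht
    filter_upwards [self_mem_nhdsWithin, eventually_quadratic_pos (c := n - t - j) (a := -1)
      (b := -1) (Or.inl (by linarith))] with ε hε0 hε
    have hε0 : 0 < ε := hε0
    rw [latticePt_add, latticePt_quadratic, latticePt_mem_region hn]
    refine ⟨by nlinarith, by positivity, by nlinarith⟩
  · intro t ht0 ht a ha
    rw [latticePt_add] at ha
    have ha' : latticePt D n t j ∈ interior (region (T a)) := by
      convert ha using 2 <;> ring
    rcases Nat.eq_zero_or_pos j with rfl | hj0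
    · exact h.notMem_interior_of_eq_zero (by simp) (h.interior_subset a ha')
    · have hfl0 : (⌊t⌋₊ : ℝ) ≤ t := Nat.floor_le ht0.le
      have hfl1 : t < ⌊t⌋₊ + 1 := Nat.lt_floor_add_one t
      obtain ⟨b, hb⟩ := hf.down hj0 ⌊t⌋₊ ((Nat.floor_lt ht0.le).2 ht)
      refine h.notMem_interior_of_mem_side (b := b) (l := 1) (l' := 0) (s := t - ⌊t⌋₊)
        (by decide) (by linarith) (by linarith) ?_ a ha'
      rw [hb.1, hb.2.1, latticePt_sub, latticePt_add]
      congr 1 <;> ring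

/-- On a foundation whose right end is passed by no side, there is a row of upright tiles: the
tiles along the foundation have to use sides of the type `AB`, and the labels at their vertices are
determined by the angles that are already there. -/
theorem row {j k : ℕ} (hf : Foundation D n T j k)
    (hend : ∀ a, Above (latticeFun D n 0 1 (-j)) (T a) →
      ¬ SidePasses (T a) (latticeVec D n 1 0) (latticePt D n k j)) :
    ∀ i < k, HasUp D n T i j := by
  have hn := h.n_pos
  have hn' : (0 : ℝ) < n := by exact_mod_cast hn
  have hb := h.rowBarrier hf
  obtain ⟨-, -, hlen⟩ := norm_latticeVec (D := D) hn
  have hfX : ∀ x : ℝ, latticeFun D n 0 1 (-j) (latticePt D n x j) = 0 := fun x => by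
    rw [latticeFun_latticePt hn]; ring
  have hX : ∀ t : ℝ, latticePt D n 0 j + t • latticeVec D n 1 0 = latticePt D n t j := by
    intro t; rw [latticePt_add]; congr 1 <;> ring
  intro i
  induction i using Nat.strong_induction_on with
  | _ i ih =>
  intro hi
  have hi' : (i : ℝ) < k := by exact_mod_cast hi
  have hup : 1 ≤ i → HasUp D n T ((i : ℝ) - 1) j := by
    intro h1
    have := ih (i - 1) (by omega) (by omega)
    rwa [Nat.cast_sub h1, Nat.cast_one] at this
  have hstart : ∀ a, Above (latticeFun D n 0 1 (-j)) (T a) →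
      ¬ SidePasses (T a) (latticeVec D n 1 0) (latticePt D n 0 j + (i : ℝ) • latticeVec D n 1 0) := by
    intro a ha hp
    rw [hX] at hp
    obtain ⟨-, hup⟩ := h.eq_up_of_label_one hf hi hup (a := a) (by rw [hp.weight]) (by
      obtain ⟨ε, h1, h2⟩ := ((hp.eventually_mem_interior ha (hfX _) hb.linear_pos).and
        self_mem_nhdsWithin).exists
      have h2 : 0 < ε := h2
      have hneg : -latticeVec D n 1 0 = latticeVec D n (-1) 0 := by
        rw [← neg_one_smul ℝ, smul_latticeVec]; simp
      rw [hneg, latticePt_quadratic] at h1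
      exact ⟨_, _, interior_subset h1, by nlinarith⟩)
    exact hp.ne_points 1 (by rw [hup.2.1, sub_add_cancel])
  have hend' : ∀ a, Above (latticeFun D n 0 1 (-j)) (T a) →
      ¬ SidePasses (T a) (latticeVec D n 1 0) (latticePt D n 0 j + (k : ℝ) • latticeVec D n 1 0) := by
    intro a ha; rw [hX]; exact hend a ha
  obtain ⟨a, jj, kk, s, ha, hs, hnext⟩ := hb.exists_side h.toIsDissection (Nat.cast_nonneg i) hi' hstart
  have hsk : (i : ℝ) + s ≤ k := by
    by_contra! hc
    refine hend' a ha ?_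
    have := hs.sidePasses (t := k - i) (by linarith) (by linarith)
    rwa [add_assoc, ← add_smul, add_sub_cancel] at this
  obtain ⟨c, hc⟩ := hb.length_eq h.toIsSimilarDissection (by have := hs.2.1; positivity) hsk hnext
    hend'
  obtain ⟨l, hlj, hlk⟩ := exists_third hs.1
  have hsl := h.side_length hs hlj hlk
  have hl2 : l = 2 := by
    refine h.label_eq_of_length (N := k - i) (x := s * ‖latticeVec D n 1 0‖)
      (y := (k - (i + s)) * ‖latticeVec D n 1 0‖) ?_ hsl hc
    rw [Nat.cast_sub hi.le, ← hlen]; ring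
  subst hl2
  have hs1 : s = 1 := h.unit_of_side_length hlen hsl
  subst hs1
  rw [hX] at hs
  have hkk : (T a).points kk = latticePt D n (i + 1) j := by
    rw [hs.2.2.2, latticePt_add]; congr 1 <;> ring
  -- the third vertex lies above the row
  have htop : ∃ x y, (T a).points 2 = latticePt D n x y ∧ (j : ℝ) < y := by
    obtain ⟨x, y, hxy⟩ := exists_eq_latticePt (D := D) hn ((T a).points 2)
    refine ⟨x, y, hxy, ?_⟩
    by_contra! hc
    have h2 : ∀ l, latticeFun D n 0 1 (-j) ((T a).points l) ≤ 0 := by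
      intro l
      rcases eq_of_distinct hlj hlk hs.1 l with rfl | rfl | rfl
      · rw [hxy, latticeFun_latticePt hn]; linarith
      · rw [hs.2.2.1, hfX]
      · rw [hkk, hfX]
    obtain ⟨ε, h1, h3⟩ := ((hs.eventually_mem_interior ha (hfX _) hb.linear_eq hb.linear_pos).and
      self_mem_nhdsWithin).exists
    have h3 : 0 < ε := h3
    have hneg : -latticeVec D n 1 0 = latticeVec D n (-1) 0 := by
      rw [← neg_one_smul ℝ, smul_latticeVec]; simp
    rw [hneg, latticePt_add, latticePt_quadratic] at h1
    have := le_of_forall_points h2 (interior_subset h1)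
    rw [latticeFun_latticePt hn] at this
    nlinarith
  obtain ⟨x, y, hxy, hy⟩ := htop
  have hpos : ∃ x' y', latticePt D n x' y' ∈ region (T a) ∧ (j : ℝ) < y' :=
    ⟨x, y, hxy ▸ points_mem_region (T a) 2, hy⟩
  have hjj : jj = 0 := by
    have h012 : jj = 0 ∨ jj = 1 :=
      (by decide : ∀ jj : Fin 3, 2 ≠ jj → jj = 0 ∨ jj = 1) jj hlj
    rcases h012 with rfl | rfl
    · rfl
    · exfalso
      obtain ⟨-, hU⟩ := h.eq_up_of_label_one hf hi hup (weight_vertex hs.2.2.1) hpos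
      have hkk0 : kk = 0 :=
        (by decide : ∀ kk : Fin 3, 2 ≠ kk → 1 ≠ kk → kk = 0) kk hlk hs.1
      subst hkk0
      have := (latticePt_inj hn (hU.1.symm.trans hkk)).1
      linarith
  subst hjj
  have hkk1 : kk = 1 :=
    (by decide : ∀ kk : Fin 3, 2 ≠ kk → 0 ≠ kk → kk = 1) kk hlk hs.1
  subst hkk1
  refine ⟨a, hs.2.2.1, hkk, ?_⟩
  have d1 := h.dist_eq a 2 0
  have d2 := h.dist_eq a 2 1
  rw [hs.2.2.1, hxy, dist_eq_norm, latticePt_sub] at d1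
  rw [hkk, hxy, dist_eq_norm, latticePt_sub] at d2
  obtain ⟨n0, n1, -⟩ := norm_latticeVec (D := D) hn
  have := apex_unique (D := D) hn (a := x - i) (b := y - j) (by linarith) (by rw [d1, n1]; rfl) (by
    rw [sub_sub, d2, n0, dist_comm]; rfl)
  rw [hxy]
  congr 1 <;> linarith [this.1, this.2]

/-- The gap between two neighbouring upright tiles is filled by the inverted tile, or by its mirror
image, whose side of the type `CA` lies along the side of the type `BC` of the left tile. -/
theorem gap {j k i : ℕ} (hf : Foundation D n T j k) (hi : i + 2 ≤ k)
    (hup : HasUp D n T i j) (hup' : HasUp D n T ((i : ℝ) + 1) j) :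
    HasDown D n T i j ∨ ∃ a, ∃ s : ℝ, 0 < s ∧ (T a).points 2 = latticePt D n ((i : ℝ) + 1) j ∧
      (T a).points 0 = latticePt D n ((i : ℝ) + 1) j + s • latticeVec D n (-1) 1 ∧
      Above (latticeFun D n 1 1 (-((i : ℝ) + 1 + j))) (T a) := by
  have hn := h.n_pos
  have hn' : (0 : ℝ) < n := by exact_mod_cast hn
  have hjk : (j : ℝ) + k ≤ n := by exact_mod_cast hf.le
  have hik : (i : ℝ) + 2 ≤ k := by exact_mod_cast hi
  have hi0 : (0 : ℝ) ≤ i := Nat.cast_nonneg i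
  have hj0 : (0 : ℝ) ≤ j := Nat.cast_nonneg j
  have label_one : ∀ a, 1 ≤ weight (T a) (latticePt D n ((i : ℝ) + 1) j) 1 →
      (∃ x' y', latticePt D n x' y' ∈ region (T a) ∧ (j : ℝ) < y') → IsUp D n (T a) i j := by
    intro a ha hy
    have := h.eq_up_of_label_one hf (i := i + 1) (by omega) (a := a)
      (fun _ => by push_cast; rw [add_sub_cancel_right]; exact hup) (by push_cast; exact ha) hy
    push_cast at this
    rw [add_sub_cancel_right] at this
    exact this.2
  have label_zero : ∀ a, 1 ≤ weight (T a) (latticePt D n ((i : ℝ) + 1) j) 0 →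
      (∃ x' y', latticePt D n x' y' ∈ region (T a) ∧ (j : ℝ) < y') →
      IsUp D n (T a) ((i : ℝ) + 1) j := by
    intro a ha hy
    have := h.eq_up_of_label_zero hf (i := i + 1) (by omega) (by omega) (a := a)
      (by push_cast; exact hup') (by push_cast; exact ha) hy
    push_cast at this
    exact this
  obtain ⟨b, hb⟩ := hup
  obtain ⟨b', hb'⟩ := hup'
  -- the tile to the right of the left side of the gap
  obtain ⟨a, ha, hcase⟩ := exists_tile_along h.toIsDissection
    (p := latticePt D n ((i : ℝ) + 1) j) (u := latticeVec D n (-1) 1) (w := latticeVec D n 1 0)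
    (f := latticeFun D n 1 1 (-((i : ℝ) + 1 + j)))
    (latticeVec_ne_zero hn (by simp)) (by rw [latticeFun_latticePt hn]; ring)
    (by rw [latticeFun_linear hn]; ring) (by rw [latticeFun_linear hn]; norm_num)
    (by
      filter_upwards [Ioo_mem_nhdsGT one_pos] with ε hε
      rw [latticePt_quadratic, latticePt_mem_region hn]
      have h1 := hε.1
      have h2 := hε.2
      refine ⟨by nlinarith, by nlinarith, by nlinarith⟩)
    (by
      filter_upwards [Ioo_mem_nhdsGT one_pos] with ε hε
      refine h.notMem_interior_of_mem_side (b := b) (l := 1) (l' := 2) (s := ε) (by decide)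
        hε.1.le hε.2.le ?_
      rw [hb.2.1, hb.2.2, latticePt_sub]
      congr 3 <;> ring)
  obtain ⟨t, ht, hmem⟩ : ∃ t : ℝ, 0 < t ∧
      latticePt D n ((i : ℝ) + 1 + t * (-1)) (j + t * 1) ∈ region (T a) := by
    rcases hcase with hp | ⟨jj, kk, s, hs⟩
    · obtain ⟨t, h1, h2⟩ := ((hp.eventually.filter_mono nhdsWithin_le_nhds).and
        (self_mem_nhdsWithin : Set.Ioi (0 : ℝ) ∈ 𝓝[>] 0)).exists
      exact ⟨t, h2, by rw [← latticePt_add]; exact h1⟩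
    · exact ⟨s, hs.2.1, by rw [← latticePt_add, ← hs.2.2.2]; exact points_mem_region _ _⟩
  have hpos : ∃ x' y', latticePt D n x' y' ∈ region (T a) ∧ (j : ℝ) < y' :=
    ⟨_, _, hmem, by linarith⟩
  have hno1 : ¬ 1 ≤ weight (T a) (latticePt D n ((i : ℝ) + 1) j) 1 := by
    intro hw
    have hU := label_one a hw hpos
    have := ha _ (points_mem_region (T a) 0)
    rw [hU.1, latticeFun_latticePt hn] at this
    linarith
  have hno0 : ¬ 1 ≤ weight (T a) (latticePt D n ((i : ℝ) + 1) j) 0 := by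
    intro hw
    have hU := label_zero a hw hpos
    have := up_le hn hU (a := -1) (b := 0) (c := -((i : ℝ) + 1)) (by linarith) (by linarith)
      (by linarith) hmem
    linarith
  obtain ⟨jj, kk, s, hs⟩ : ∃ jj kk s, SideFrom (T a) (latticeVec D n (-1) 1)
      (latticePt D n ((i : ℝ) + 1) j) s jj kk := by
    rcases hcase with hp | hs
    · exact absurd (by rw [hp.weight]) hno1
    · exact hs
  have hjj : jj = 2 := by
    have h012 : jj = 0 ∨ jj = 1 ∨ jj = 2 :=
      (by decide : ∀ k : Fin 3, k = 0 ∨ k = 1 ∨ k = 2) jj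
    rcases h012 with rfl | rfl | rfl
    · exact absurd (weight_vertex hs.2.2.1) hno0
    · exact absurd (weight_vertex hs.2.2.1) hno1
    · rfl
  subst hjj
  -- the tile to the left of the right side of the gap
  obtain ⟨a', ha', hcase'⟩ := exists_tile_along h.toIsDissection
    (p := latticePt D n ((i : ℝ) + 1) j) (u := latticeVec D n 0 1) (w := latticeVec D n (-1) 0)
    (f := latticeFun D n (-1) 0 ((i : ℝ) + 1))
    (latticeVec_ne_zero hn (by simp)) (by rw [latticeFun_latticePt hn]; ring)
    (by rw [latticeFun_linear hn]; ring) (by rw [latticeFun_linear hn]; norm_num)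
    (by
      filter_upwards [Ioo_mem_nhdsGT one_pos] with ε hε
      rw [latticePt_quadratic, latticePt_mem_region hn]
      have h1 := hε.1
      have h2 := hε.2
      refine ⟨by nlinarith, by nlinarith, by nlinarith⟩)
    (by
      filter_upwards [Ioo_mem_nhdsGT one_pos] with ε hε
      refine h.notMem_interior_of_mem_side (b := b') (l := 0) (l' := 2) (s := ε) (by decide)
        hε.1.le hε.2.le ?_
      rw [hb'.1, hb'.2.2, latticePt_sub]
      congr 3 <;> ring)
  obtain ⟨t', ht', hmem'⟩ : ∃ t : ℝ, 0 < t ∧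
      latticePt D n ((i : ℝ) + 1 + t * 0) (j + t * 1) ∈ region (T a') := by
    rcases hcase' with hp | ⟨jj, kk, s, hs⟩
    · obtain ⟨t, h1, h2⟩ := ((hp.eventually.filter_mono nhdsWithin_le_nhds).and
        (self_mem_nhdsWithin : Set.Ioi (0 : ℝ) ∈ 𝓝[>] 0)).exists
      exact ⟨t, h2, by rw [← latticePt_add]; exact h1⟩
    · exact ⟨s, hs.2.1, by rw [← latticePt_add, ← hs.2.2.2]; exact points_mem_region _ _⟩
  have hpos' : ∃ x' y', latticePt D n x' y' ∈ region (T a') ∧ (j : ℝ) < y' :=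
    ⟨_, _, hmem', by linarith⟩
  have hno1' : ¬ 1 ≤ weight (T a') (latticePt D n ((i : ℝ) + 1) j) 1 := by
    intro hw
    have hU := label_one a' hw hpos'
    have := up_le hn hU (a := 1) (b := 1) (c := (i : ℝ) + 1 + j) (by linarith) (by linarith)
      (by linarith) hmem'
    linarith
  have hno0' : ¬ 1 ≤ weight (T a') (latticePt D n ((i : ℝ) + 1) j) 0 := by
    intro hw
    have hU := label_zero a' hw hpos'
    have := ha' _ (points_mem_region (T a') 1)
    rw [hU.2.1, latticeFun_latticePt hn] at this
    linarith
  obtain ⟨jj', kk', s', hs'⟩ : ∃ jj kk s, SideFrom (T a') (latticeVec D n 0 1)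
      (latticePt D n ((i : ℝ) + 1) j) s jj kk := by
    rcases hcase' with hp | hs
    · exact absurd (by rw [hp.weight]) hno1'
    · exact hs
  have hjj' : jj' = 2 := by
    have h012 : jj' = 0 ∨ jj' = 1 ∨ jj' = 2 :=
      (by decide : ∀ k : Fin 3, k = 0 ∨ k = 1 ∨ k = 2) jj'
    rcases h012 with rfl | rfl | rfl
    · exact absurd (weight_vertex hs'.2.2.1) hno0'
    · exact absurd (weight_vertex hs'.2.2.1) hno1'
    · rfl
  subst hjj'
  -- both tiles have the angle with label two at the gap, hence they coincide
  have haa : a = a' := by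
    refine h.unique_label_two hf (i := i + 1) (by omega) ?_ ?_ hpos hpos'
    · push_cast; exact weight_vertex hs.2.2.1
    · push_cast; exact weight_vertex hs'.2.2.1
  subst haa
  have hkk : kk = 0 ∧ kk' = 1 ∨ kk = 1 ∧ kk' = 0 := by
    have h1 := hs.1
    have h2 := hs'.1
    have h3 : kk ≠ kk' := by
      rintro rfl
      have h4 := hs.2.2.2.symm.trans hs'.2.2.2
      rw [latticePt_add, latticePt_add] at h4
      have := (latticePt_inj hn h4).1
      have := hs.2.1
      linarith
    exact (by decide : ∀ kk kk' : Fin 3, 2 ≠ kk → 2 ≠ kk' → kk ≠ kk' →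
      kk = 0 ∧ kk' = 1 ∨ kk = 1 ∧ kk' = 0) kk kk' h1 h2 h3
  rcases hkk with ⟨rfl, rfl⟩ | ⟨rfl, rfl⟩
  · exact Or.inr ⟨a, s, hs.2.1, hs.2.2.1, hs.2.2.2, ha⟩
  · left
    obtain ⟨n0, n1, -⟩ := norm_latticeVec (D := D) hn
    have e1 : s = 1 := h.unit_of_side_length n0 (h.side_length hs (l := 0) (by decide) (by decide))
    have e2 : s' = 1 := h.unit_of_side_length n1 (h.side_length hs' (l := 1) (by decide) (by decide))
    subst e1 e2
    refine ⟨a, ?_, ?_, hs.2.2.1⟩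
    · rw [hs'.2.2.2, latticePt_add]; congr 1 <;> ring
    · rw [hs.2.2.2, latticePt_add]; congr 1 <;> ring

end IsLatticeDissection

end

/-! ### No gap is filled by a mirror image -/

section

variable {D : Tri} {n m : ℕ} {T : Fin m → Tri}

namespace IsLatticeDissection

variable (h : IsLatticeDissection D n T)
include h

lemma lineBarrier {j₀ r k : ℕ} (hk : 1 ≤ k) (hkn : k + (j₀ + r) < n)
    (hups : HasUp D n T ((k : ℝ) - 1) ((j₀ : ℝ) + r))
    (hleft : ∀ s < r, HasUp D n T ((k : ℝ) + r - 1 - s) ((j₀ : ℝ) + s)) :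
    IsBarrier D T (latticeFun D n 1 1 (-((k : ℝ) + r + j₀))) (latticePt D n ((k : ℝ) + r) j₀)
      (latticeVec D n (-1) 1) (latticeVec D n 1 0) ((r : ℝ) + 1) := by
  have hn := h.n_pos
  have hkn' : (k : ℝ) + (j₀ + r) < n := by exact_mod_cast hkn
  have hk' : (1 : ℝ) ≤ k := by exact_mod_cast hk
  have hj' : (0 : ℝ) ≤ j₀ := Nat.cast_nonneg _
  refine ⟨latticeVec_ne_zero hn (by simp), ?_, ?_, ?_, ?_, ?_⟩
  · rw [latticeFun_latticePt hn]; ring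
  · rw [latticeFun_linear hn]; ring
  · rw [latticeFun_linear hn]; norm_num
  · intro t ht0 ht
    filter_upwards [self_mem_nhdsWithin,
      eventually_quadratic_pos (c := (k : ℝ) + r - t) (a := -1) (b := 1) (Or.inl (by linarith)),
      eventually_quadratic_pos (c := (n : ℝ) - (k + (j₀ + r))) (a := 0) (b := -1)
        (Or.inl (by linarith))] with ε hε0 hε1 hε2
    have hε0 : 0 < ε := hε0
    rw [latticePt_add, latticePt_quadratic, latticePt_mem_region hn]
    refine ⟨by nlinarith, by nlinarith, by nlinarith⟩
  · intro t ht0 ht a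
    have hfl0 : (⌊t⌋₊ : ℝ) ≤ t := Nat.floor_le ht0.le
    have hfl1 : t < ⌊t⌋₊ + 1 := Nat.lt_floor_add_one t
    have hfl2 : ⌊t⌋₊ < r + 1 := (Nat.floor_lt ht0.le).2 (by push_cast; exact ht)
    obtain ⟨b, hb⟩ : HasUp D n T ((k : ℝ) + r - 1 - ⌊t⌋₊) ((j₀ : ℝ) + ⌊t⌋₊) := by
      rcases Nat.lt_succ_iff_lt_or_eq.1 hfl2 with hlt | heq
      · exact hleft _ hlt
      · rw [heq]; convert hups using 1; ring
    refine h.notMem_interior_of_mem_side (b := b) (l := 1) (l' := 2) (s := t - ⌊t⌋₊) (by decide)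
      (by linarith) (by linarith) ?_ a
    rw [hb.2.1, hb.2.2, latticePt_sub, latticePt_add, latticePt_add]
    congr 1 <;> ring

/-- A line of `r` sides of the type `BC`, whose other side begins with a mirrored tile, continues
beyond a further side of the type `BC`: otherwise a multiple of `BC` would be a sum of sides, one
of which is `CA`. -/
lemma exists_passing {j₀ r k : ℕ} (hk : 1 ≤ k) (hkn : k + (j₀ + r) < n)
    (hups : HasUp D n T ((k : ℝ) - 1) ((j₀ : ℝ) + r))
    (hleft : ∀ s < r, HasUp D n T ((k : ℝ) + r - 1 - s) ((j₀ : ℝ) + s))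
    {a : Fin m} {σ : ℝ} (hσ : 0 < σ) (ha2 : (T a).points 2 = latticePt D n ((k : ℝ) + r) j₀)
    (ha0 : (T a).points 0 = latticePt D n ((k : ℝ) + r) j₀ + σ • latticeVec D n (-1) 1)
    (ha : Above (latticeFun D n 1 1 (-((k : ℝ) + r + j₀))) (T a)) :
    ∃ b, Above (latticeFun D n 1 1 (-((k : ℝ) + r + j₀))) (T b) ∧
      SidePasses (T b) (latticeVec D n (-1) 1) (latticePt D n ((k : ℝ) - 1) ((j₀ : ℝ) + r + 1)) := by
  have hn := h.n_pos
  have hb := h.lineBarrier hk hkn hups hleft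
  have hY : latticePt D n ((k : ℝ) + r) j₀ + ((r : ℝ) + 1) • latticeVec D n (-1) 1 =
      latticePt D n ((k : ℝ) - 1) ((j₀ : ℝ) + r + 1) := by
    rw [latticePt_add]; congr 1 <;> ring
  by_contra! hend
  rw [← hY] at hend
  have hs : SideFrom (T a) (latticeVec D n (-1) 1) (latticePt D n ((k : ℝ) + r) j₀) σ 2 0 :=
    ⟨by decide, hσ, ha2, ha0⟩
  have hσr : σ ≤ (r : ℝ) + 1 := by
    by_contra! hc
    exact hend a ha (hs.sidePasses (by positivity) hc)
  obtain ⟨c, hc⟩ := hb.length_eq h.toIsSimilarDissection hσ.le hσr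
    (fun i' hi' => not_sidePasses_of_sideFrom h.toIsDissection hb.apply_eq hb.linear_eq
      hb.linear_pos ha hs hi') hend
  obtain ⟨n0, -, -⟩ := norm_latticeVec (D := D) hn
  have := h.label_eq_of_length (l := 0) (l' := 1) (N := r + 1) (c := c)
    (x := σ * ‖latticeVec D n (-1) 1‖) (y := ((r : ℝ) + 1 - σ) * ‖latticeVec D n (-1) 1‖)
    (by rw [← n0]; push_cast; ring) (h.side_length hs (by decide) (by decide)) hc
  exact absurd this (by decide)

/-- A mirrored tile in a gap forces its left neighbourhood to be a strip of rows between `AC` and a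
line of sides parallel to `BC`, and these rows get shorter and shorter, which cannot go on.
The mirrored tile `a` stands to the right of the line, with its vertex `2` at the lattice point
`(k + r, j₀)` and its side of type `CA` along the line. To the left of the line there are the sides
of `r` upright tiles, up to the row at the height `j₀ + r`, which has `k` upright tiles. -/
theorem no_mirror : ∀ (k r j₀ : ℕ), 1 ≤ k → Foundation D n T (j₀ + r) k → k + (j₀ + r) < n →
    (∀ i < k, HasUp D n T i ((j₀ : ℝ) + r)) →
    (∀ s < r, HasUp D n T ((k : ℝ) + r - 1 - s) ((j₀ : ℝ) + s)) →
    ∀ (a : Fin m) (σ : ℝ), 0 < σ → (T a).points 2 = latticePt D n ((k : ℝ) + r) j₀ →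
    (T a).points 0 = latticePt D n ((k : ℝ) + r) j₀ + σ • latticeVec D n (-1) 1 →
    ¬ Above (latticeFun D n 1 1 (-((k : ℝ) + r + j₀))) (T a) := by
  have hn := h.n_pos
  intro k
  induction k using Nat.strong_induction_on with
  | _ k ih =>
  intro r j₀ hk hf hkn hups hleft a σ hσ ha2 ha0 ha
  have hlast : HasUp D n T ((k : ℝ) - 1) ((j₀ : ℝ) + r) := by
    have := hups (k - 1) (by omega)
    rwa [Nat.cast_sub hk, Nat.cast_one] at this
  -- a tile to the right of the line passes the right end of the next row
  obtain ⟨b, hb, hpass⟩ := h.exists_passing hk hkn hlast hleft hσ ha2 ha0 ha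
  obtain ⟨k', rfl⟩ : ∃ k', k = k' + 1 := ⟨k - 1, by omega⟩
  have hYx : (((k' + 1 : ℕ) : ℝ) - 1) = k' := by push_cast; ring
  rw [hYx] at hpass hlast
  rcases Nat.eq_zero_or_pos k' with rfl | hk'
  · -- the strip ends on the side `AC`
    obtain ⟨c, hc⟩ := hlast
    refine h.false_of_two (p := latticePt D n ((0 : ℕ) : ℝ) ((j₀ : ℝ) + r + 1)) (k := 2)
      (h.notMem_interior_of_eq_zero (by simp)) (i := b) (j := c) ?_ (by rw [hpass.weight])
      (weight_vertex hc.2.2)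
    rintro rfl
    exact hpass.ne_points 2 hc.2.2.symm
  · -- a mirrored tile in a gap of the row begins a new line, over a shorter row
    have hdowns : ∀ i < k', HasDown D n T i ((j₀ : ℝ) + r) := by
      intro i hi
      have h1 := hups i (by omega)
      have h2 := hups (i + 1) (by omega)
      push_cast at h2
      have hg := h.gap (i := i) hf (by omega) (by push_cast; exact h1) (by push_cast; exact h2)
      push_cast at hg
      rcases hg with hd | ⟨a', s', hs', e2, e0, habove⟩
      · exact hd
      · exfalso
        refine ih (i + 1) (by omega) 0 (j₀ + r) (by omega) (hf.mono (by omega)) (by omega)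
          (fun i' hi' => ?_) (fun s hs => absurd hs (by omega)) a' s' hs' ?_ ?_ ?_
        · have := hups i' (by omega)
          push_cast; rwa [add_zero]
        · push_cast; rwa [add_zero]
        · push_cast; rwa [add_zero]
        · push_cast; rwa [add_zero]
    have hf' : Foundation D n T (j₀ + (r + 1)) k' := by
      refine ⟨by omega, fun _ i hi => ?_, fun _ i hi => ?_⟩
      · have := hdowns i hi
        convert this using 1; push_cast; ring
      · have := hups i (by omega)
        convert this using 1; push_cast; ring
    -- the tile `b` and the last inverted tile already use up the two angles with label `0` at the
    -- right end of the next row, so that no side of this row passes there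
    have hrow := h.row hf' (by
      intro a' ha' hp
      obtain ⟨c, hc⟩ := hdowns (k' - 1) (by omega)
      rw [Nat.cast_sub hk', Nat.cast_one] at hc
      have hpt : latticePt D n k' ((j₀ + (r + 1) : ℕ) : ℝ) =
          latticePt D n k' ((j₀ : ℝ) + r + 1) := by congr 1; push_cast; ring
      rw [hpt] at hp
      have hcY : (T c).points 0 = latticePt D n k' ((j₀ : ℝ) + r + 1) := by
        rw [hc.1]; congr 1; ring
      refine h.false_of_three (p := latticePt D n k' ((j₀ : ℝ) + r + 1)) (k := 0)
        (i := a') (j := b) (l := c) ?_ ?_ ?_ (by rw [hp.weight]) (by rw [hpass.weight])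
        (weight_vertex hcY)
      · rintro rfl
        have hev : ∀ᶠ ε in 𝓝 (0 : ℝ), latticePt D n k' ((j₀ : ℝ) + r + 1) +
            (-ε) • latticeVec D n 1 0 ∈ region (T a') := by
          have := hp.eventually
          exact (continuous_neg.tendsto' (0 : ℝ) 0 neg_zero).eventually this
        obtain ⟨ε, h1, h2⟩ := ((hev.filter_mono nhdsWithin_le_nhds).and
          (self_mem_nhdsWithin : Set.Ioi (0 : ℝ) ∈ 𝓝[>] 0)).exists
        have h2 : 0 < ε := h2
        rw [latticePt_add] at h1
        have := hb _ h1
        rw [latticeFun_latticePt hn] at this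
        push_cast at this
        linarith
      · rintro rfl; exact hp.ne_points 0 hcY.symm
      · rintro rfl; exact hpass.ne_points 0 hcY.symm)
    refine ih k' (by omega) (r + 1) j₀ hk' hf' (by omega) (fun i hi => ?_) (fun s hs => ?_) a σ hσ
      ?_ ?_ ?_
    · have := hrow i hi
      convert this using 1; push_cast; ring
    · rcases Nat.lt_succ_iff_lt_or_eq.1 hs with hlt | rfl
      · convert hleft s hlt using 1; push_cast; ring
      · convert hlast using 1; push_cast; ring
    · rw [ha2]; congr 1; push_cast; ring
    · rw [ha0]; congr 2; push_cast; ring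
    · convert ha using 2; push_cast; ring

/-- All lattice triangles are tiles. -/
theorem hasUp_and_hasDown (j : ℕ) (hj : j < n) : (∀ i < n - j, HasUp D n T i j) ∧
    ∀ i < n - j - 1, HasDown D n T i j := by
  have hn := h.n_pos
  suffices H : ∀ j : ℕ, j < n → Foundation D n T j (n - j) →
      (∀ i < n - j, HasUp D n T i j) ∧ ∀ i < n - j - 1, HasDown D n T i j by
    have hfound : ∀ j : ℕ, j < n → Foundation D n T j (n - j) := by
      intro j
      induction j with
      | zero => exact fun _ => ⟨by omega, fun h0 => absurd h0 (by omega),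
          fun h0 => absurd h0 (by omega)⟩
      | succ j ih =>
        intro hj
        obtain ⟨hu, hd⟩ := H j (by omega) (ih (by omega))
        refine ⟨by omega, fun _ i hi => ?_, fun _ i hi => ?_⟩
        · push_cast; rw [add_sub_cancel_right]; exact hd i (by omega)
        · push_cast; rw [add_sub_cancel_right]; exact hu i (by omega)
    exact H j hj (hfound j hj)
  intro j hj hf
  have hrow := h.row hf (by
    intro a ha hp
    rcases Nat.eq_zero_or_pos j with rfl | hj0
    · have hB : latticePt D n ((n - 0 : ℕ) : ℝ) ((0 : ℕ) : ℝ) = D.points 1 := by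
        rw [(points_eq_latticePt hn).2.1]; simp
      have := h.weight_one_le (i := a) (p := D.points 1) (k := 0) (by rw [← hB, hp.weight])
      rw [weight_points] at this
      simp at this
    · obtain ⟨c, hc⟩ := hf.down hj0 (n - j - 1) (by omega)
      have hcY : (T c).points 0 = latticePt D n ((n - j : ℕ) : ℝ) j := by
        rw [hc.1, Nat.cast_sub (by omega : 1 ≤ n - j)]; congr 1 <;> push_cast <;> ring
      refine h.false_of_two (i := a) (j := c) (k := 0) ?_ ?_ (by rw [hp.weight])
        (weight_vertex hcY)
      · refine h.notMem_interior_of_eq_zero (Or.inr (Or.inr ?_))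
        rw [Nat.cast_sub hj.le]; ring
      · rintro rfl; exact hp.ne_points 0 hcY.symm)
  refine ⟨hrow, fun i hi => ?_⟩
  have h1 := hrow i (by omega)
  have h2 := hrow (i + 1) (by omega)
  push_cast at h2
  rcases h.gap (i := i) hf (by omega) h1 h2 with hd | ⟨a', s', hs', e2, e0, habove⟩
  · exact hd
  · exfalso
    refine h.no_mirror (i + 1) 0 j (by omega) (hf.mono (by omega)) (by omega)
      (fun i' hi' => ?_) (fun s hs => absurd hs (by omega)) a' s' hs' ?_ ?_ ?_
    · have := hrow i' (by omega)
      push_cast; rwa [add_zero]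
    · push_cast; rwa [add_zero]
    · push_cast; rwa [add_zero]
    · push_cast; rwa [add_zero]

end IsLatticeDissection

end

/-! ### Lattice tiles and the standard dissection -/

section

variable {D : Tri} {n m : ℕ} {T : Fin m → Tri}

lemma region_eq_image {S : Tri} {f : Plane →ᵃ[ℝ] Plane} (h : ∀ k, S.points k = f (D.points k)) :
    region S = f '' region D := by
  rw [region, region, f.image_convexHull, ← Set.range_comp]
  congr 2
  exact funext h

lemma region_eq_upTile (hn : 0 < n) {S : Tri} {i j : ℕ} (h : IsUp D n S i j) :
    region S = upTile D n i j := by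
  have hn' : (n : ℝ) ≠ 0 := by positivity
  refine region_eq_image (f := AffineMap.const ℝ Plane (latticePoint D n i j) +
    (1 / (n : ℝ)) • (AffineMap.id ℝ Plane - AffineMap.const ℝ Plane (D.points 0))) fun k => ?_
  change S.points k = latticePoint D n i j + (1 / (n : ℝ)) • (D.points k - D.points 0)
  obtain ⟨h0, h1, h2⟩ := h
  obtain ⟨d0, d1, d2⟩ := points_eq_latticePt (D := D) hn
  rw [latticePoint_eq, d0]
  fin_cases k
  · simp only [Fin.zero_eta]
    rw [h0, d0, latticePt_sub, latticePt_add]; congr 1 <;> simp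
  · simp only [Fin.mk_one]
    rw [h1, d1, latticePt_sub, latticePt_add]; congr 1 <;> simp [hn']
  · simp only [Fin.reduceFinMk]
    rw [h2, d2, latticePt_sub, latticePt_add]; congr 1 <;> simp [hn']

lemma region_eq_downTile (hn : 0 < n) {S : Tri} {i j : ℕ} (h : IsDown D n S i j) :
    region S = downTile D n i j := by
  have hn' : (n : ℝ) ≠ 0 := by positivity
  refine region_eq_image (f := AffineMap.const ℝ Plane (latticePoint D n (i + 1) (j + 1)) -
    (1 / (n : ℝ)) • (AffineMap.id ℝ Plane - AffineMap.const ℝ Plane (D.points 0))) fun k => ?_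
  change S.points k = latticePoint D n (i + 1) (j + 1) - (1 / (n : ℝ)) • (D.points k - D.points 0)
  obtain ⟨h0, h1, h2⟩ := h
  obtain ⟨d0, d1, d2⟩ := points_eq_latticePt (D := D) hn
  rw [latticePoint_eq, d0, sub_eq_add_neg, ← neg_smul]
  fin_cases k
  · simp only [Fin.zero_eta]
    rw [h0, d0, latticePt_sub, latticePt_add]; congr 1 <;> simp
  · simp only [Fin.mk_one]
    rw [h1, d1, latticePt_sub, latticePt_add]; congr 1 <;> simp [hn']
  · simp only [Fin.reduceFinMk]
    rw [h2, d2, latticePt_sub, latticePt_add]; congr 1 <;> simp [hn']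

lemma latticePt_mem_upTile (hn : 0 < n) {i j : ℕ} {x y : ℝ} (hx : (i : ℝ) ≤ x) (hy : (j : ℝ) ≤ y)
    (hxy : x + y ≤ i + j + 1) : latticePt D n x y ∈ upTile D n i j := by
  have hn' : (0 : ℝ) < n := by positivity
  refine ⟨latticePt D n (n * (x - i)) (n * (y - j)), (latticePt_mem_region hn).2
    ⟨by nlinarith, by nlinarith, by nlinarith⟩, ?_⟩
  simp only
  rw [latticePoint_eq, (points_eq_latticePt (D := D) hn).1, latticePt_sub, latticePt_add]
  congr 1 <;> field_simp <;> ring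

lemma latticePt_mem_downTile (hn : 0 < n) {i j : ℕ} {x y : ℝ} (hx : x ≤ i + 1) (hy : y ≤ j + 1)
    (hxy : (i : ℝ) + j + 1 ≤ x + y) : latticePt D n x y ∈ downTile D n i j := by
  have hn' : (0 : ℝ) < n := by positivity
  refine ⟨latticePt D n (n * (i + 1 - x)) (n * (j + 1 - y)), (latticePt_mem_region hn).2
    ⟨by nlinarith, by nlinarith, by nlinarith⟩, ?_⟩
  simp only
  rw [latticePoint_eq, (points_eq_latticePt (D := D) hn).1, latticePt_sub, sub_eq_add_neg,
    ← neg_smul, latticePt_add]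
  push_cast
  congr 1 <;> field_simp <;> ring

namespace IsLatticeDissection

/-- The tiles are exactly the triangles of the standard dissection: all these are tiles, and they
leave no room for others. -/
theorem range_region (h : IsLatticeDissection D n T) :
    Set.range (fun i => region (T i)) = standardDissection D n := by
  have hn := h.n_pos
  have hup : ∀ i j : ℕ, i + j + 1 ≤ n → ∃ l, region (T l) = upTile D n i j := fun i j hij => by
    obtain ⟨l, hl⟩ := (h.hasUp_and_hasDown j (by omega)).1 i (by omega)
    exact ⟨l, region_eq_upTile hn hl⟩
  have hdown : ∀ i j : ℕ, i + j + 2 ≤ n → ∃ l, region (T l) = downTile D n i j :=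
    fun i j hij => by
      obtain ⟨l, hl⟩ := (h.hasUp_and_hasDown j (by omega)).2 i (by omega)
      exact ⟨l, region_eq_downTile hn hl⟩
  apply subset_antisymm
  · -- an interior point of a tile is also in some lattice triangle, which is a tile
    rintro _ ⟨k, rfl⟩
    obtain ⟨p, hp⟩ := interior_region_nonempty (T k)
    obtain ⟨x, y, rfl⟩ := exists_eq_latticePt (D := D) hn p
    obtain ⟨hx, hy, hxy⟩ := (latticePt_mem_interior hn).1 (h.interior_subset k hp)
    have hx1 := Nat.floor_le hx.le
    have hy1 := Nat.floor_le hy.le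
    have hx2 := Nat.lt_floor_add_one x
    have hy2 := Nat.lt_floor_add_one y
    rcases le_total (x + y) (⌊x⌋₊ + ⌊y⌋₊ + 1) with hle | hle
    · have hij : ⌊x⌋₊ + ⌊y⌋₊ + 1 ≤ n := by
        have : ((⌊x⌋₊ + ⌊y⌋₊ : ℕ) : ℝ) < n := by push_cast; linarith
        exact Nat.succ_le_of_lt (by exact_mod_cast this)
      obtain ⟨l, hl⟩ := hup _ _ hij
      have : k = l := h.eq_of_mem_interior hp (hl ▸ latticePt_mem_upTile hn hx1 hy1 hle)
      exact Or.inl ⟨_, _, hij, this ▸ hl⟩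
    · have hij : ⌊x⌋₊ + ⌊y⌋₊ + 2 ≤ n := by
        have : ((⌊x⌋₊ + ⌊y⌋₊ + 1 : ℕ) : ℝ) < n := by push_cast; linarith
        exact Nat.succ_le_of_lt (by exact_mod_cast this)
      obtain ⟨l, hl⟩ := hdown _ _ hij
      have : k = l := h.eq_of_mem_interior hp (hl ▸ latticePt_mem_downTile hn hx2.le hy2.le hle)
      exact Or.inr ⟨_, _, hij, this ▸ hl⟩
  · rintro _ (⟨i, j, hij, rfl⟩ | ⟨i, j, hij, rfl⟩)
    · exact hup i j hij
    · exact hdown i j hij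

end IsLatticeDissection

end

end TriangleTiling

theorem theorem2 :
    MeasureTheory.volume TriangleTiling.exceptionalSet = 0 ∧
      ∀ D : TriangleTiling.Tri,
        TriangleTiling.shape D ∉ TriangleTiling.exceptionalSet →
        ∀ (m : ℕ) (T : Fin m → TriangleTiling.Tri),
          TriangleTiling.IsCongruentDissection D T →
          ∃ n : ℕ, 1 ≤ n ∧ m = n ^ 2 ∧
            Set.range (fun i => TriangleTiling.region (T i)) =
              TriangleTiling.standardDissection D n := by
  open TriangleTiling in
  refine ⟨volume_exceptionalSet, fun D hD m T hT => ?_⟩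
  have hang := anglesIndependent_of_shape hD
  have hside := sidesIndependent_of_shape hD
  obtain ⟨ρ, T', hT', hreg⟩ := hT.exists_similar hang
  obtain ⟨n, hn, hm, rfl⟩ := hT'.exists_ratio hang hside
  have h : IsLatticeDissection D n T' :=
    ⟨hT', hn, sum_weight hT'.toIsDissection hT'.ang_eq hang, sum_side_inj hside⟩
  refine ⟨n, hn, hm, ?_⟩
  simp only [← hreg]
  exact h.range_region
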